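/- Let $\Omega\subset\mathbb R^d$ be a bounded open set with Lipschitz boundary, let $\partial_u\Omega\neq\emptyset$ and $\partial_q\Omega$ be disjoint measurable subsets of $\partial\Omega$ with $\overline{\partial_u\Omega\cup\partial_q\Omega}=\partial\Omega$, let $I=[0,T]$ with $T>0$, and let $P=P_1\times\dots\times P_{n_p}$ with bounded $P_j\subset\mathbb R$. For each $p\in P$ let $c(\cdot,p)$, $k(\cdot,p)$, $r(\cdot,p)$ be measurable functions on $\Omega$ bounded above and below by positive constants (which may depend on $p$). Let $f_d\in L^2(I;L^2(\Omega))$ and $g_d\in L^2(I;L^2(\partial_q\Omega))$. Let $\mathcal V$ be the space of functions in $H^1(\Omega)$ whose trace vanishes on $\partial_u\Omega$, with the $H^1$ norm, and write $\ell_t(v)=\int_\Omega f_d(t)v\,d\Omega+\int_{\partial_q\Omega}g_d(t)v\,dS$. For each $p$ let $W_p$ be the space of $w\in L^2(I;\mathcal V)$ with $c\,\partial_t w\in L^2(I;\mathcal V^*)$, where $c\,\partial_t w$ is the weak time derivative of the functional $v\mapsto\int_\Omega c\,w(t)v\,d\Omega$, so that $\int_\Omega c\,\partial_t w\,v$ denotes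 a duality pairing; elements of $W_p$ are identified with their representatives in $C([0,T];L^2(\Omega))$. For each $p\in P$ let $u=u(p)\in W_p$ solve the diffusion–reaction problem $$u(0)=0,\qquad \int_I\int_\Omega\big(c\,\partial_t u\,v+k\nabla u\cdot\nabla v+r\,u\,v\big)\,d\Omega\,dt=\int_I\ell_t(v(t))\,dt\quad\text{for all }v\in L^2(I;\mathcal V),$$ and put $q=k\nabla u$, $z=ru$. Write $\|w\|_k^2=\int_\Omega k|\nabla w|^2$, $\|w\|_r^2=\int_\Omega r w^2$, $\|\tau\|_{k^{-1}}^2=\int_\Omega k^{-1}|\tau|^2$, $\|y\|_{r^{-1}}^2=\int_\Omega r^{-1}y^2$, $|||\cdot|||_\square^2=\int_I\|\cdot\|_\square^2\,dt$, $\|w\|_c^2=\int_\Omega c\,w(T)^2$, and $|||w|||^2=|||w|||_k^2+|||w|||_r^2+\|w\|_c^2$. (1) Fix $p\in P$ and let $(\hat u,\hat q,\hat z)$ be any admissible triplet, i.e. $\hat u\in W_p$ (so $\hat u=0$ on $\partial_u\Omega$), $\hat u(0)=0$, $\hat q\in L^2(I;L^2(\Omega)^d)$, $\hat z\in L^2(I;L^2(\Omega))$,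 and for a.e. $t\in I$ $$\int_\Omega\big(c\,\partial_t\hat u\,v+\hat q\cdot\nabla v+\hat z\,v\big)\,d\Omega=\ell_t(v)\quad\text{for all }v\in\mathcal V.$$ Let $E_{\mathrm{CRE}}^2=\int_I\int_\Omega\big(\tfrac1k|\hat q-k\nabla\hat u|^2+\tfrac1r(\hat z-r\hat u)^2\big)\,d\Omega\,dt$. Then $$E_{\mathrm{CRE}}^2=|||q-\hat q|||_{k^{-1}}^2+|||z-\hat z|||_{r^{-1}}^2+|||u-\hat u|||_k^2+|||u-\hat u|||_r^2+\|u-\hat u\|_c^2\ \ge\ |||u-\hat u|||^2,$$ and, with $\hat q^*=\tfrac12(\hat q+k\nabla\hat u)$ and $\hat z^*=\tfrac12(\hat z+r\hat u)$, $$\tfrac12E_{\mathrm{CRE}}^2=2\,|||q-\hat q^*|||_{k^{-1}}^2+2\,|||z-\hat z^*|||_{r^{-1}}^2+\|u-\hat u\|_c^2.$$ (2) Let $u_m(x,t,p)=\sum_{i=1}^m\psi_i(x)\lambda_i(t)\prod_{j=1}^{n_p}\gamma_{j,i}(p_j)$ be a separated (PGD) approximation with $\psi_i\in\mathcal V$,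 $\lambda_i\in H^1(I)$, $\gamma_{j,i}\in L^2(P_j)$ and $u_m(\cdot,0,p)=0$ for all $p\in P$, and for each $p\in P$ let $\hat q_m\in L^2(I;L^2(\Omega)^d)$ be a flux in full equilibrium with $u_m$: for a.e. $t\in I$, $$\int_\Omega\big(c\,\partial_tu_m\,v+\hat q_m\cdot\nabla v+r\,u_m\,v\big)\,d\Omega=\ell_t(v)\quad\text{for all }v\in\mathcal V.$$ Then for every $p\in P$ the quantity $E_{\mathrm{CRE}}$ of the triplet $(u_m,\hat q_m,r u_m)$ satisfies $$E_{\mathrm{CRE}}^2=|||\hat q_m-k\nabla u_m|||_{k^{-1}}^2\ \ge\ |||u-u_m|||_k^2+|||u-u_m|||_r^2+\|u-u_m\|_c^2=|||u-u_m|||^2.$$ -/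

import Mathlib

open MeasureTheory Set
open scoped ContDiff NNReal RealInnerProductSpace

namespace CRE

/-- Physical space `ℝ^d` with its Euclidean norm. -/
abbrev Space (d : ℕ) : Type := EuclideanSpace ℝ (Fin d)

/-- `L²(Ω)`. -/
abbrev ScalarL2 {d : ℕ} (Ω : Set (Space d)) : Type := Lp ℝ 2 (volume.restrict Ω)

/-- `L²(Ω; ℝ^d)`. -/
abbrev VectorL2 {d : ℕ} (Ω : Set (Space d)) : Type := Lp (Space d) 2 (volume.restrict Ω)

/-- Pairs (scalar field, vector field) with the norm `(‖v‖² + ‖w‖²)^(1/2)`; on pairs `(v, ∇v)` this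
is the norm of `H¹(Ω)`. -/
abbrev FieldPair {d : ℕ} (Ω : Set (Space d)) : Type := WithLp 2 (ScalarL2 Ω × VectorL2 Ω)

/-- Surface measure on `∂Ω`: the (normalized) `(d-1)`-dimensional Hausdorff measure. -/
noncomputable def surfaceMeasure {d : ℕ} (Ω : Set (Space d)) : Measure (Space d) :=
  (Measure.euclideanHausdorffMeasure (d - 1)).restrict (frontier Ω)

/-- `L²(∂Ω)`. -/
abbrev BoundaryL2 {d : ℕ} (Ω : Set (Space d)) : Type := Lp ℝ 2 (surfaceMeasure Ω)

/-- Bounded open sets with Lipschitz boundary: near each boundary point, `Ω` is the strict epigraph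
of a Lipschitz function over a hyperplane. -/
structure IsLipschitzDomain {d : ℕ} (Ω : Set (Space d)) : Prop where
  isOpen : IsOpen Ω
  isBounded : Bornology.IsBounded Ω
  locally_epigraph : ∀ x ∈ frontier Ω, ∃ ν : Space d, ‖ν‖ = 1 ∧
    ∃ (K : ℝ≥0) (h : (ℝ ∙ ν)ᗮ → ℝ), LipschitzWith K h ∧
      ∃ ρ > 0, ∀ y ∈ Metric.ball x ρ,
        (y ∈ Ω ↔ h ((ℝ ∙ ν)ᗮ.orthogonalProjectionOnto y) < ⟪ν, y⟫)

/-- `G` is the weak (distributional) gradient of `v` in `Ω`. -/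
def HasWeakGradient {d : ℕ} (Ω : Set (Space d)) (v : ScalarL2 Ω) (G : VectorL2 Ω) : Prop :=
  ∀ φ : Space d → ℝ, ContDiff ℝ ∞ φ → HasCompactSupport φ → tsupport φ ⊆ Ω → ∀ a : Space d,
    ∫ x in Ω, v x * fderiv ℝ φ x a = - ∫ x in Ω, ⟪G x, a⟫ * φ x

theorem integrable_mul_test {d : ℕ} {Ω : Set (Space d)} {v : Space d → ℝ}
    (hv : MemLp v 2 (volume.restrict Ω)) {φ : Space d → ℝ} (hφ : Continuous φ)
    (hc : HasCompactSupport φ) : Integrable (fun x => v x * φ x) (volume.restrict Ω) :=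
  MemLp.integrable_mul (p := 2) (q := 2) hv (hφ.memLp_of_hasCompactSupport hc)

/-- The Sobolev space `H¹(Ω)`, its elements being the pairs `(v, ∇v)`. -/
def H1 {d : ℕ} (Ω : Set (Space d)) : Submodule ℝ (FieldPair Ω) where
  carrier := {w | HasWeakGradient Ω w.fst w.snd}
  zero_mem' := by
    intro φ _ _ _ a
    have h1 : (fun x => (((0 : FieldPair Ω).fst : ScalarL2 Ω) : Space d → ℝ) x * fderiv ℝ φ x a)
        =ᵐ[volume.restrict Ω] 0 := by
      filter_upwards [Lp.coeFn_zero ℝ 2 (volume.restrict Ω)] with x hx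
      simp only [WithLp.zero_fst, hx, Pi.zero_apply, zero_mul]
    have h2 : (fun x => ⟪(((0 : FieldPair Ω).snd : VectorL2 Ω) : Space d → Space d) x, a⟫ * φ x)
        =ᵐ[volume.restrict Ω] 0 := by
      filter_upwards [Lp.coeFn_zero (Space d) 2 (volume.restrict Ω)] with x hx
      simp only [WithLp.zero_snd, hx, Pi.zero_apply, inner_zero_left, zero_mul]
    rw [integral_congr_ae h1, integral_congr_ae h2]
    simp
  add_mem' := by
    intro w w' hw hw' φ hφ hc hs a
    have hd : Continuous fun x => fderiv ℝ φ x a :=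
      (hφ.continuous_fderiv (by simp)).clm_apply continuous_const
    have hdc : HasCompactSupport fun x => fderiv ℝ φ x a := hc.fderiv_apply (𝕜 := ℝ) a
    have h1 : (fun x => ((w + w').fst : Space d → ℝ) x * fderiv ℝ φ x a)
        =ᵐ[volume.restrict Ω] fun x => w.fst x * fderiv ℝ φ x a + w'.fst x * fderiv ℝ φ x a := by
      filter_upwards [Lp.coeFn_add w.fst w'.fst] with x hx
      simp only [WithLp.add_fst, hx, Pi.add_apply]
      ring
    have h2 : (fun x => ⟪((w + w').snd : Space d → Space d) x, a⟫ * φ x)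
        =ᵐ[volume.restrict Ω] fun x => ⟪w.snd x, a⟫ * φ x + ⟪w'.snd x, a⟫ * φ x := by
      filter_upwards [Lp.coeFn_add w.snd w'.snd] with x hx
      simp only [WithLp.add_snd, hx, Pi.add_apply, inner_add_left]
      ring
    rw [integral_congr_ae h1, integral_congr_ae h2,
      integral_add (integrable_mul_test (Lp.memLp _) hd hdc)
        (integrable_mul_test (Lp.memLp _) hd hdc),
      integral_add (integrable_mul_test ((Lp.memLp w.snd).inner_const a) hφ.continuous hc)
        (integrable_mul_test ((Lp.memLp w'.snd).inner_const a) hφ.continuous hc),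
      hw φ hφ hc hs a, hw' φ hφ hc hs a]
    ring
  smul_mem' := by
    intro s w hw φ hφ hc hs a
    have h1 : (fun x => ((s • w).fst : Space d → ℝ) x * fderiv ℝ φ x a)
        =ᵐ[volume.restrict Ω] fun x => s * (w.fst x * fderiv ℝ φ x a) := by
      filter_upwards [Lp.coeFn_smul s w.fst] with x hx
      simp only [WithLp.smul_fst, hx, Pi.smul_apply, smul_eq_mul]
      ring
    have h2 : (fun x => ⟪((s • w).snd : Space d → Space d) x, a⟫ * φ x)
        =ᵐ[volume.restrict Ω] fun x => s * (⟪w.snd x, a⟫ * φ x) := by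
      filter_upwards [Lp.coeFn_smul s w.snd] with x hx
      simp only [WithLp.smul_snd, hx, Pi.smul_apply, real_inner_smul_left]
      ring
    rw [integral_congr_ae h1, integral_congr_ae h2, integral_const_mul, integral_const_mul,
      hw φ hφ hc hs a]
    ring

/-- The graph of the classical restriction map: triples `((φ|_Ω, ∇φ|_Ω), φ|_∂Ω)` for smooth
`φ : ℝ^d → ℝ` (with `φ|_Ω`, `∇φ|_Ω`, `φ|_∂Ω` square integrable, as is automatic for bounded
Lipschitz `Ω`). -/
noncomputable def smoothTraceGraph {d : ℕ} (Ω : Set (Space d)) :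
    Submodule ℝ (FieldPair Ω × BoundaryL2 Ω) where
  carrier := {z | ∃ φ : Space d → ℝ, ContDiff ℝ ∞ φ ∧
    (∀ᵐ x ∂volume.restrict Ω, z.1.fst x = φ x) ∧
    (∀ᵐ x ∂volume.restrict Ω, z.1.snd x = gradient φ x) ∧
    (∀ᵐ x ∂surfaceMeasure Ω, z.2 x = φ x)}
  zero_mem' := by
    refine ⟨0, contDiff_const, ?_, ?_, ?_⟩
    · filter_upwards [Lp.coeFn_zero ℝ 2 (volume.restrict Ω)] with x hx
      simp only [Prod.fst_zero, WithLp.zero_fst, hx, Pi.zero_apply]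
    · filter_upwards [Lp.coeFn_zero (Space d) 2 (volume.restrict Ω)] with x hx
      simp only [Prod.fst_zero, WithLp.zero_snd, hx, Pi.zero_apply]
      simp [gradient]
    · filter_upwards [Lp.coeFn_zero ℝ 2 (surfaceMeasure Ω)] with x hx
      simp only [Prod.snd_zero, hx, Pi.zero_apply]
  add_mem' := by
    rintro z z' ⟨φ, hφ, h1, h2, h3⟩ ⟨φ', hφ', h1', h2', h3'⟩
    refine ⟨φ + φ', hφ.add hφ', ?_, ?_, ?_⟩
    · filter_upwards [Lp.coeFn_add z.1.fst z'.1.fst, h1, h1'] with x hx e e'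
      simp only [Prod.fst_add, WithLp.add_fst, hx, Pi.add_apply, e, e']
    · filter_upwards [Lp.coeFn_add z.1.snd z'.1.snd, h2, h2'] with x hx e e'
      have hd := (hφ.differentiable (by simp)) x
      have hd' := (hφ'.differentiable (by simp)) x
      simp only [Prod.fst_add, WithLp.add_snd, hx, Pi.add_apply, e, e', gradient,
        fderiv_add hd hd', map_add]
    · filter_upwards [Lp.coeFn_add z.2 z'.2, h3, h3'] with x hx e e'
      simp only [Prod.snd_add, hx, Pi.add_apply, e, e']
  smul_mem' := by
    rintro s z ⟨φ, hφ, h1, h2, h3⟩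
    refine ⟨s • φ, contDiff_const.smul hφ, ?_, ?_, ?_⟩
    · filter_upwards [Lp.coeFn_smul s z.1.fst, h1] with x hx e
      simp [hx, e]
    · filter_upwards [Lp.coeFn_smul s z.1.snd, h2] with x hx e
      have hd := (hφ.differentiable (by simp)) x
      simp [hx, e, gradient, fderiv_const_smul hd s]
    · filter_upwards [Lp.coeFn_smul s z.2, h3] with x hx e
      simp [hx, e]

/-- `τ` is the trace on `∂Ω` of the `H¹` function `w = (v, ∇v)`: the closure, in
`H¹(Ω) × L²(∂Ω)`, of the restriction map on smooth functions. For a bounded Lipschitz `Ω`, every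
`w` in `H¹(Ω)` has exactly one trace. -/
def IsTrace {d : ℕ} (Ω : Set (Space d)) (w : FieldPair Ω) (τ : BoundaryL2 Ω) : Prop :=
  (w, τ) ∈ (smoothTraceGraph Ω).topologicalClosure

open Classical in
/-- The trace operator. -/
noncomputable def trace {d : ℕ} {Ω : Set (Space d)} (w : FieldPair Ω) : BoundaryL2 Ω :=
  if h : ∃ τ, IsTrace Ω w τ then h.choose else 0

/-- The space `𝒱` of the functions in `H¹(Ω)` with zero trace on `Γu`, with the norm of `H¹(Ω)`. -/
noncomputable def V {d : ℕ} (Ω Γu : Set (Space d)) : Submodule ℝ (FieldPair Ω) where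
  carrier := {w | w ∈ H1 Ω ∧ ∃ τ : BoundaryL2 Ω, IsTrace Ω w τ ∧
    ∀ᵐ x ∂(surfaceMeasure Ω).restrict Γu, τ x = 0}
  zero_mem' := by
    refine ⟨Submodule.zero_mem _, 0, Submodule.zero_mem _, ?_⟩
    filter_upwards [ae_restrict_of_ae (Lp.coeFn_zero ℝ 2 (surfaceMeasure Ω))] with x hx
    simp only [hx, Pi.zero_apply]
  add_mem' := by
    rintro w w' ⟨hw, τ, hτ, h0⟩ ⟨hw', τ', hτ', h0'⟩
    refine ⟨Submodule.add_mem _ hw hw', τ + τ', Submodule.add_mem _ hτ hτ', ?_⟩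
    filter_upwards [ae_restrict_of_ae (Lp.coeFn_add τ τ'), h0, h0'] with x hx e e'
    simp only [hx, Pi.add_apply, e, e', add_zero]
  smul_mem' := by
    rintro s w ⟨hw, τ, hτ, h0⟩
    refine ⟨Submodule.smul_mem _ s hw, s • τ, Submodule.smul_mem _ s hτ, ?_⟩
    filter_upwards [ae_restrict_of_ae (Lp.coeFn_smul s τ), h0] with x hx e
    simp [hx, e]

/-- The function `v` underlying an element of `𝒱`. -/
noncomputable def fn {d : ℕ} {Ω Γu : Set (Space d)} (v : V Ω Γu) : ScalarL2 Ω :=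
  (v : FieldPair Ω).fst

/-- The weak gradient `∇v` of an element of `𝒱`. -/
noncomputable def grad {d : ℕ} {Ω Γu : Set (Space d)} (v : V Ω Γu) : VectorL2 Ω :=
  (v : FieldPair Ω).snd

/-- Lebesgue measure on the time interval `I = [0, T]`. -/
noncomputable def timeMeasure (T : ℝ) : Measure ℝ := volume.restrict (Icc 0 T)

/-- Coefficients in `Ω`: measurable, and bounded above and below by positive constants. -/
def IsPositiveCoefficient {d : ℕ} (Ω : Set (Space d)) (w : Space d → ℝ) : Prop :=
  AEMeasurable w (volume.restrict Ω) ∧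
    ∃ α β : ℝ, 0 < α ∧ ∀ᵐ x ∂volume.restrict Ω, α ≤ w x ∧ w x ≤ β

/-- Functions `u ∈ L²(I; 𝒱)` with `c ∂u/∂t ∈ L²(I; 𝒱*)`. The product `c ∂u/∂t` is the
weak time derivative of the functional `v ↦ ∫_Ω c u(t) v` (recall that `c` is independent of
time), so the duality pairing extends the inner product of `L²(Ω)`. As usual such a function is
identified with its representative in `C([0, T]; L²(Ω))`, which gives the values at `t = 0` and
`t = T`. -/
structure ParabolicSpace {d : ℕ} (Ω Γu : Set (Space d)) (T : ℝ) (c : Space d → ℝ) where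
  /-- The function, as an element of `L²(I; 𝒱)`. -/
  toFun : ℝ → V Ω Γu
  /-- The functional `c ∂u/∂t` in `L²(I; 𝒱*)`. -/
  cdt : ℝ → StrongDual ℝ (V Ω Γu)
  /-- The continuous representative with values in `L²(Ω)`. -/
  rep : ℝ → ScalarL2 Ω
  memLp_toFun : MemLp toFun 2 (timeMeasure T)
  memLp_cdt : MemLp cdt 2 (timeMeasure T)
  continuousOn_rep : ContinuousOn rep (Icc 0 T)
  rep_ae_eq : ∀ᵐ t ∂timeMeasure T, rep t = fn (toFun t)
  weak_derivative : ∀ φ : ℝ → ℝ, ContDiff ℝ ∞ φ → HasCompactSupport φ → tsupport φ ⊆ Ioo 0 T →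
    ∀ v : V Ω Γu,
      ∫ t, deriv φ t * (∫ x in Ω, c x * fn (toFun t) x * fn v x) ∂timeMeasure T
        = - ∫ t, φ t * cdt t v ∂timeMeasure T

/-- The loading `∫_Ω f v + ∫_Γq g v dS` at a given time. -/
noncomputable def load {d : ℕ} {Ω Γu : Set (Space d)} (Γq : Set (Space d)) (f : ScalarL2 Ω)
    (g : Lp ℝ 2 ((surfaceMeasure Ω).restrict Γq)) (v : V Ω Γu) : ℝ :=
  (∫ x in Ω, f x * fn v x) + ∫ x in Γq, g x * trace (v : FieldPair Ω) x ∂surfaceMeasure Ω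

/-- `u` solves the space-time weak formulation: `u(0) = 0` and `b(u, v) = l(v)` for all
`v ∈ L²(I; 𝒱)`. -/
def IsWeakSolution {d : ℕ} {Ω Γu Γq : Set (Space d)} {T : ℝ} {c : Space d → ℝ}
    (k r : Space d → ℝ) (f : ℝ → ScalarL2 Ω)
    (g : ℝ → Lp ℝ 2 ((surfaceMeasure Ω).restrict Γq)) (u : ParabolicSpace Ω Γu T c) : Prop :=
  u.rep 0 = 0 ∧
  ∀ v : ℝ → V Ω Γu, MemLp v 2 (timeMeasure T) →
    ∫ t, (u.cdt t (v t) + ∫ x in Ω, (k x * ⟪grad (u.toFun t) x, grad (v t) x⟫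
        + r x * fn (u.toFun t) x * fn (v t) x)) ∂timeMeasure T
      = ∫ t, load Γq (f t) (g t) (v t) ∂timeMeasure T

/-- Admissible triplets `(û, q̂, ẑ)`: zero initial data, zero Dirichlet data on `Γu` (through the
values in `𝒱`), and weak equilibrium in space at (almost) every time. -/
structure IsAdmissible {d : ℕ} {Ω Γu Γq : Set (Space d)} {T : ℝ} {c : Space d → ℝ}
    (f : ℝ → ScalarL2 Ω) (g : ℝ → Lp ℝ 2 ((surfaceMeasure Ω).restrict Γq))
    (û : ParabolicSpace Ω Γu T c) (q : ℝ → VectorL2 Ω) (z : ℝ → ScalarL2 Ω) : Prop where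
  initial : û.rep 0 = 0
  memLp_q : MemLp q 2 (timeMeasure T)
  memLp_z : MemLp z 2 (timeMeasure T)
  equilibrium : ∀ᵐ t ∂timeMeasure T, ∀ v : V Ω Γu,
    û.cdt t v + ∫ x in Ω, (⟪q t x, grad v x⟫ + z t x * fn v x) = load Γq (f t) (g t) v

/-- The weighted squared norm `∫_Ω w ‖F‖²`, for scalar or vector fields `F`. -/
noncomputable def normSq {d : ℕ} {G : Type*} [NormedAddCommGroup G] (Ω : Set (Space d))
    (w : Space d → ℝ) (F : Space d → G) : ℝ :=
  ∫ x in Ω, w x * ‖F x‖ ^ 2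

/-- The space-time weighted squared norm `∫_I ∫_Ω w ‖F‖²`. -/
noncomputable def triNormSq {d : ℕ} {G : Type*} [NormedAddCommGroup G] (Ω : Set (Space d)) (T : ℝ)
    (w : Space d → ℝ) (F : ℝ → Space d → G) : ℝ :=
  ∫ t, normSq Ω w (F t) ∂timeMeasure T

/-- The squared constitutive relation error `E_CRE²` of `(û, q̂, ẑ)`:
`∫_I ∫_Ω (k⁻¹ ‖q̂ - k ∇û‖² + r⁻¹ (ẑ - r û)²)`. -/
noncomputable def creSq {d : ℕ} {Ω Γu : Set (Space d)} (T : ℝ) (k r : Space d → ℝ)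
    (û : ℝ → V Ω Γu) (q : ℝ → Space d → Space d) (z : ℝ → Space d → ℝ) : ℝ :=
  ∫ t, (∫ x in Ω, ((1 / k x) * ‖q t x - k x • grad (û t) x‖ ^ 2
    + (1 / r x) * (z t x - r x * fn (û t) x) ^ 2)) ∂timeMeasure T

/-- The squared energy norm `|||e|||² = |||e|||_k² + |||e|||_r² + ∫_Ω c e(T)²`, the final value
`e(T)` being given as `eT`. -/
noncomputable def energyNormSq {d : ℕ} {Ω Γu : Set (Space d)} (T : ℝ) (c k r : Space d → ℝ)
    (e : ℝ → V Ω Γu) (eT : ScalarL2 Ω) : ℝ :=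
  triNormSq Ω T k (fun t => grad (e t)) + triNormSq Ω T r (fun t => fn (e t)) + normSq Ω c eT

/-- Separated (PGD) representations
`u_m(x, t, p) = ∑ i, ψ_i(x) λ_i(t) ∏ j, γ_{j,i}(p_j)`, vanishing at `t = 0`, with space modes in `𝒱`,
time modes in `H¹(I)` and parameter modes in `L²(P_j)`. -/
structure PGDApproximation {d np : ℕ} (Ω Γu : Set (Space d)) (T : ℝ) (P : Fin np → Set ℝ)
    (m : ℕ) where
  /-- Space modes. -/
  space : Fin m → V Ω Γu
  /-- Time modes. -/
  time : Fin m → ℝ → ℝ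
  /-- Parameter modes. -/
  param : Fin m → Fin np → ℝ → ℝ
  time_ac : ∀ i, AbsolutelyContinuousOnInterval (time i) 0 T
  time_deriv : ∀ i, MemLp (deriv (time i)) 2 (timeMeasure T)
  param_memLp : ∀ i j, MemLp (param i j) 2 (volume.restrict (P j))
  initial : ∀ p ∈ Set.univ.pi P, ∑ i, (time i 0 * ∏ j, param i j (p j)) • space i = 0

/-- The value `u_m(·, t, p) ∈ 𝒱`. -/
noncomputable def PGDApproximation.eval {d np m : ℕ} {Ω Γu : Set (Space d)} {T : ℝ}
    {P : Fin np → Set ℝ} (U : PGDApproximation Ω Γu T P m) (p : Fin np → ℝ) (t : ℝ) : V Ω Γu :=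
  ∑ i, (U.time i t * ∏ j, U.param i j (p j)) • U.space i

/-- The time derivative `∂u_m/∂t (·, t, p) ∈ 𝒱`. -/
noncomputable def PGDApproximation.evalDeriv {d np m : ℕ} {Ω Γu : Set (Space d)} {T : ℝ}
    {P : Fin np → Set ℝ} (U : PGDApproximation Ω Γu T P m) (p : Fin np → ℝ) (t : ℝ) : V Ω Γu :=
  ∑ i, (deriv (U.time i) t * ∏ j, U.param i j (p j)) • U.space i

/-- The flux `q̂_m` (for the parameter value `p`) is in full weak equilibrium with `u_m`. -/
structure IsEquilibratedFlux {d np m : ℕ} {Ω Γu Γq : Set (Space d)} {T : ℝ}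
    {P : Fin np → Set ℝ} (c r : Space d → ℝ) (f : ℝ → ScalarL2 Ω)
    (g : ℝ → Lp ℝ 2 ((surfaceMeasure Ω).restrict Γq)) (U : PGDApproximation Ω Γu T P m)
    (p : Fin np → ℝ) (q : ℝ → VectorL2 Ω) : Prop where
  memLp_q : MemLp q 2 (timeMeasure T)
  equilibrium : ∀ᵐ t ∂timeMeasure T, ∀ v : V Ω Γu,
    ∫ x in Ω, (c x * fn (U.evalDeriv p t) x * fn v x + ⟪q t x, grad v x⟫
        + r x * fn (U.eval p t) x * fn v x) = load Γq (f t) (g t) v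

end CRE

open CRE

/-! Everything rests on completing a square. For a coefficient `w`, a gradient `U` of the exact
solution, a gradient `H` of the approximation and a flux `Q`, write `w H - Q = (w U - Q) - w (U -
H)` and expand in the norm weighted by `1 / w`: the mismatch of `(H, Q)` is that of `(U, Q)` plus
the energy of `U - H` minus twice the work of `w U - Q` on `U - H`. The same expansion of `w U - (Q
+ w H) / 2` gives the identity for averaged fluxes. It is applied with `w = k` to gradients and with
`w = r` to values.

The two work terms are then evaluated together. Testing both the weak problem and the equilibrium of
the triplet with the error `e = u - û` removes the load, so the total work is minus the time
integral of the pairing of `c ∂e/∂t` with `e` (`integral_cross_add_integral_cross`). As `e(0) = 0`,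
twice this integral is `∫ c e(T)²`.

That last fact is the analytic core, `energy_identity`: a weak chain rule for the square of a
function that is only in `L²(I; 𝒱)` with derivative in the dual. It is obtained from difference
quotients in time and continuity of translations in `L²`. The weak derivative is first turned into
true increments by the du Bois-Reymond lemma. For a separated approximation, integrating by parts in
each time mode places it in the parabolic space; with `ẑ = r û` the reaction mismatch vanishes. -/

namespace CRE

/-! ### Weak derivatives on a time interval. -/

theorem eq_zero_of_tsupport_subset_Ioo {φ : ℝ → ℝ} {a b x : ℝ} (hs : tsupport φ ⊆ Ioo a b)
    (hx : x ∉ Ioo a b) : φ x = 0 := by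
  by_contra h
  exact hx (hs (subset_tsupport φ h))

/-- Integration by parts of an absolutely continuous function against a test function. -/
theorem integral_deriv_test_mul {T : ℝ} (hT : 0 < T) {l φ : ℝ → ℝ}
    (hl : AbsolutelyContinuousOnInterval l 0 T) (hφ : ContDiff ℝ ∞ φ)
    (hs : tsupport φ ⊆ Ioo 0 T) :
    ∫ t in Icc 0 T, deriv φ t * l t = - ∫ t in Icc 0 T, φ t * deriv l t := by
  have hac : AbsolutelyContinuousOnInterval φ 0 T :=
    ((hφ.of_le (by simp)).contDiffOn).absolutelyContinuousOnInterval
  have h := hac.integral_mul_deriv_eq_deriv_mul hl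
  rw [eq_zero_of_tsupport_subset_Ioo hs (x := 0) (by simp),
    eq_zero_of_tsupport_subset_Ioo hs (x := T) (by simp),
    intervalIntegral.integral_of_le hT.le, intervalIntegral.integral_of_le hT.le] at h
  rw [integral_Icc_eq_integral_Ioc, integral_Icc_eq_integral_Ioc, h]
  ring

/-- A smooth function with vanishing integral and compact support in an interval has a primitive
of the same kind. -/
theorem exists_primitive_test {a b : ℝ} {ψ : ℝ → ℝ} (hψ : ContDiff ℝ ∞ ψ)
    (hc : HasCompactSupport ψ) (hs : tsupport ψ ⊆ Ioo a b) (h0 : ∫ x, ψ x = 0) :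
    ∃ φ : ℝ → ℝ, ContDiff ℝ ∞ φ ∧ HasCompactSupport φ ∧ tsupport φ ⊆ Ioo a b ∧ deriv φ = ψ := by
  rcases (tsupport ψ).eq_empty_or_nonempty with he | hne
  · refine ⟨0, contDiff_const, HasCompactSupport.zero, by simp, ?_⟩
    rw [tsupport_eq_empty_iff] at he
    rw [he]
    ext x
    simp
  have hcomp : IsCompact (tsupport ψ) := hc
  obtain ⟨α, hα, hαm⟩ := hcomp.exists_isLeast hne
  obtain ⟨β, hβ, hβm⟩ := hcomp.exists_isGreatest hne
  have hzero : ∀ x, x ∉ Icc α β → ψ x = 0 := fun x hx => by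
    by_contra h
    exact hx ⟨hαm (subset_tsupport ψ h), hβm (subset_tsupport ψ h)⟩
  -- The primitive is anchored at the least point `α` of the support: it vanishes to the left of
  -- `α`, and to the right of `β` it equals the whole integral of `ψ`, which is zero.
  have hsupp : Function.support (fun x => ∫ y in α..x, ψ y) ⊆ Icc α β := by
    intro x hx
    by_contra hxm
    apply hx
    simp only [mem_Icc, not_and_or, not_le] at hxm
    rcases hxm with hlt | hlt
    · refine (intervalIntegral.integral_congr_ae_restrict (g := fun _ => 0) ?_).trans (by simp)
      rw [uIoc_of_ge hlt.le]
      have : ∀ᵐ y ∂(volume : Measure ℝ), y ≠ α := by simp [ae_iff]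
      filter_upwards [ae_restrict_mem measurableSet_Ioc, ae_restrict_of_ae this] with y hy hne
      exact hzero y fun h => hne (le_antisymm hy.2 h.1)
    · rw [← h0]
      have hss : Function.support ψ ⊆ Icc α x := fun y hy => by
        by_contra hyx
        exact hy (hzero y fun h => hyx ⟨h.1, h.2.trans hlt.le⟩)
      have hle : α ≤ x := (hαm hβ).trans hlt.le
      simp only
      rw [intervalIntegral.integral_of_le hle, ← integral_Icc_eq_integral_Ioc,
        setIntegral_eq_integral_of_forall_compl_eq_zero]
      intro y hy
      by_contra h
      exact hy (hss h)
  have hder : ∀ x, HasDerivAt (fun x => ∫ y in α..x, ψ y) (ψ x) x := fun x =>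
    intervalIntegral.integral_hasDerivAt_right (hψ.continuous.intervalIntegrable _ _)
      (hψ.continuous.stronglyMeasurableAtFilter _ _) hψ.continuous.continuousAt
  have hd : deriv (fun x => ∫ y in α..x, ψ y) = ψ := funext fun x => (hder x).deriv
  have hts : tsupport (fun x => ∫ y in α..x, ψ y) ⊆ Icc α β :=
    closure_minimal hsupp isClosed_Icc
  refine ⟨fun x => ∫ y in α..x, ψ y, ?_, ?_, ?_, hd⟩
  · rw [contDiff_infty_iff_deriv, hd]
    exact ⟨fun x => (hder x).differentiableAt, hψ⟩
  · exact isCompact_Icc.of_isClosed_subset (isClosed_tsupport _) hts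
  · exact hts.trans fun x hx => ⟨(hs hα).1.trans_le hx.1, hx.2.trans_lt (hs hβ).2⟩

/-- **Du Bois-Reymond lemma**: a continuous function on `[0, T]` with vanishing weak derivative is
constant. -/
theorem eq_of_weak_derivative_zero {T : ℝ} (hT : 0 < T) {h : ℝ → ℝ}
    (hh : ContinuousOn h (Icc 0 T))
    (hw : ∀ φ : ℝ → ℝ, ContDiff ℝ ∞ φ → HasCompactSupport φ → tsupport φ ⊆ Ioo 0 T →
      ∫ t in Icc 0 T, deriv φ t * h t = 0) :
    ∃ C, ∀ t ∈ Icc 0 T, h t = C := by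
  have hint : IntegrableOn h (Icc 0 T) := hh.integrableOn_Icc
  -- Outer radius `T / 4` around the midpoint keeps the closed support inside the open interval.
  let B : ContDiffBump (T / 2) := ⟨T / 8, T / 4, by positivity, by linarith⟩
  set ρ : ℝ → ℝ := B.normed volume with hρ
  have hρd : ContDiff ℝ ∞ ρ := B.contDiff_normed
  have hρc : HasCompactSupport ρ := B.hasCompactSupport_normed
  have hρs : tsupport ρ ⊆ Ioo 0 T := by
    rw [hρ, B.tsupport_normed_eq, Real.closedBall_eq_Icc]
    intro x hx
    have h1 : T / 2 - T / 4 ≤ x := hx.1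
    have h2 : x ≤ T / 2 + T / 4 := hx.2
    constructor <;> linarith
  have hρi : ∫ x, ρ x = 1 := B.integral_normed
  set C : ℝ := ∫ t in Icc 0 T, ρ t * h t with hC
  have key : ∀ᵐ x, x ∈ Ioo 0 T → h x - C = 0 := by
    refine IsOpen.ae_eq_zero_of_integral_contDiff_smul_eq_zero isOpen_Ioo ?_ ?_
    · exact ((hint.mono_set Ioo_subset_Icc_self).sub
        (integrableOn_const (by simp))).locallyIntegrableOn
    · intro ψ hψ hψc hψs
      set M : ℝ := ∫ x, ψ x with hM
      -- Subtracting `M * ρ` from `ψ` cancels its mass, so the difference is the derivative of a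
      -- test function; hence `∫ ψ h = M * C`.
      obtain ⟨φ, h1, h2, h3, h4⟩ := exists_primitive_test (a := 0) (b := T)
        (ψ := fun x => ψ x - M * ρ x) (hψ.sub (contDiff_const.mul hρd))
        (hψc.sub (hρc.mul_left (f := fun _ => M)))
        ((tsupport_sub _ _).trans (union_subset hψs
          ((tsupport_mul_subset_right (f := fun _ => M) (g := ρ)).trans hρs)))
        (by
          rw [integral_sub (hψ.continuous.integrable_of_hasCompactSupport hψc)
            ((hρd.continuous.integrable_of_hasCompactSupport hρc).const_mul M),
            integral_const_mul, hρi, hM]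
          ring)
      have h5 := hw φ h1 h2 h3
      rw [h4] at h5
      have i1 : IntegrableOn (fun t => ψ t * h t) (Icc 0 T) :=
        hint.continuousOn_mul hψ.continuous.continuousOn isCompact_Icc
      have i2 : IntegrableOn (fun t => ρ t * h t) (Icc 0 T) :=
        hint.continuousOn_mul hρd.continuous.continuousOn isCompact_Icc
      have h6 : ∫ t in Icc 0 T, ψ t * h t = M * C := by
        have : ∀ t, (ψ t - M * ρ t) * h t = ψ t * h t - M * (ρ t * h t) := fun t => by ring
        simp_rw [this] at h5
        rw [integral_sub i1 (i2.const_mul M), integral_const_mul] at h5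
        linarith
      have h7 : ∫ t in Icc 0 T, ψ t = M :=
        setIntegral_eq_integral_of_forall_compl_eq_zero fun x hx =>
          eq_zero_of_tsupport_subset_Ioo hψs fun hx' => hx (Ioo_subset_Icc_self hx')
      rw [← setIntegral_eq_integral_of_forall_compl_eq_zero (s := Icc 0 T) (fun x hx => by
        rw [eq_zero_of_tsupport_subset_Ioo hψs fun hx' => hx (Ioo_subset_Icc_self hx'), zero_smul])]
      simp_rw [smul_eq_mul, mul_sub]
      rw [integral_sub i1 (hψ.continuous.continuousOn.integrableOn_Icc.mul_const C),
        integral_mul_const, h6, h7, sub_self]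
  refine ⟨C, fun t ht => ?_⟩
  have h1 : h =ᵐ[volume.restrict (Ioo 0 T)] fun _ => C := by
    filter_upwards [ae_restrict_of_ae key, ae_restrict_mem measurableSet_Ioo] with x h1 h2
    linarith [h1 h2]
  have h2 : EqOn h (fun _ => C) (Ioo 0 T) :=
    Measure.eqOn_open_of_ae_eq h1 isOpen_Ioo (hh.mono Ioo_subset_Icc_self) continuousOn_const
  exact h2.of_subset_closure hh continuousOn_const Ioo_subset_Icc_self
    (by rw [closure_Ioo hT.ne]) ht

/-- A continuous function on `[0, T]` with an integrable weak derivative is its integral. -/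
theorem sub_eq_integral_of_weak_derivative {T : ℝ} (hT : 0 < T) {h F : ℝ → ℝ}
    (hh : ContinuousOn h (Icc 0 T)) (hF : IntegrableOn F (Icc 0 T))
    (hw : ∀ φ : ℝ → ℝ, ContDiff ℝ ∞ φ → HasCompactSupport φ → tsupport φ ⊆ Ioo 0 T →
      ∫ t in Icc 0 T, deriv φ t * h t = - ∫ t in Icc 0 T, φ t * F t)
    {s t : ℝ} (hs : s ∈ Icc 0 T) (ht : t ∈ Icc 0 T) : h t - h s = ∫ x in s..t, F x := by
  have hFi : IntervalIntegrable F volume 0 T :=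
    (intervalIntegrable_iff_integrableOn_Icc_of_le hT.le).2 hF
  set G : ℝ → ℝ := fun x => ∫ y in (0 : ℝ)..x, F y with hG
  have hac : AbsolutelyContinuousOnInterval G 0 T :=
    hFi.absolutelyContinuousOnInterval_intervalIntegral (c := 0) (by simp)
  have hGc : ContinuousOn G (Icc 0 T) := by simpa [uIcc_of_le hT.le] using hac.continuousOn
  have hder : ∀ᵐ x ∂volume.restrict (Icc 0 T), deriv G x = F x := by
    filter_upwards [ae_restrict_of_ae hFi.ae_hasDerivAt_integral,
      ae_restrict_mem measurableSet_Icc] with x h1 h2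
    exact (h1 (by rwa [uIcc_of_le hT.le]) 0 (by simp)).deriv
  -- `G` has weak derivative `F` by integration by parts, so `h - G` is constant.
  obtain ⟨C, hC⟩ := eq_of_weak_derivative_zero hT (hh.sub hGc) fun φ h1 h2 h3 => by
    have hφ' : ContinuousOn (deriv φ) (Icc 0 T) := (h1.continuous_deriv (by simp)).continuousOn
    have e : ∫ t in Icc 0 T, deriv φ t * G t = - ∫ t in Icc 0 T, φ t * F t := by
      rw [integral_deriv_test_mul hT hac h1 h3]
      congr 1
      apply integral_congr_ae
      filter_upwards [hder] with x hx
      rw [hx]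
    simp only [Pi.sub_apply, mul_sub]
    rw [integral_sub (f := fun t => deriv φ t * h t) (g := fun t => deriv φ t * G t)
      (hφ'.mul hh).integrableOn_Icc (hφ'.mul hGc).integrableOn_Icc, hw φ h1 h2 h3, e, sub_self]
  have e1 := hC t ht
  have e2 := hC s hs
  simp only [Pi.sub_apply] at e1 e2
  have hsub : ∀ x ∈ Icc 0 T, IntervalIntegrable F volume 0 x := fun x hx =>
    hFi.mono_set (by rw [uIcc_of_le hT.le, uIcc_of_le hx.1]; exact Icc_subset_Icc_right hx.2)
  rw [← intervalIntegral.integral_interval_sub_left (hsub t ht) (hsub s hs)]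
  simp only [hG] at e1 e2
  linarith

/-! ### Translations in time and pairings of square integrable functions. -/

section Pairing

open Filter Topology

variable {X Z : Type*} [NormedAddCommGroup X] [NormedSpace ℝ X] [NormedAddCommGroup Z]
  [NormedSpace ℝ Z] (B : Z →L[ℝ] X →L[ℝ] ℝ)

/-- The pairing `∫_A B(F(t), w(t)) dt` of square integrable functions. -/
noncomputable def pairing (A : Set ℝ) (F : Lp Z 2 (volume : Measure ℝ))
    (w : Lp X 2 (volume : Measure ℝ)) : ℝ :=
  B.lpPairing (volume.restrict A) 2 2
    (LpToLpRestrictCLM ℝ Z ℝ volume 2 A F) (LpToLpRestrictCLM ℝ X ℝ volume 2 A w)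

theorem pairing_eq_integral (A : Set ℝ) (F : Lp Z 2 (volume : Measure ℝ))
    (w : Lp X 2 (volume : Measure ℝ)) : pairing B A F w = ∫ t in A, B (F t) (w t) := by
  rw [pairing, ContinuousLinearMap.lpPairing_eq_integral]
  apply integral_congr_ae
  filter_upwards [LpToLpRestrictCLM_coeFn ℝ A F, LpToLpRestrictCLM_coeFn ℝ A w] with t h1 h2
  rw [h1, h2]

theorem continuous_pairing (A : Set ℝ) {f : ℝ × ℝ → Lp Z 2 (volume : Measure ℝ)}
    (hf : Continuous f) {g : ℝ × ℝ → Lp X 2 (volume : Measure ℝ)} (hg : Continuous g) :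
    Continuous fun z => pairing B A (f z) (g z) := by
  have h1 := (LpToLpRestrictCLM ℝ Z ℝ volume 2 A).continuous.comp hf
  have h2 := (LpToLpRestrictCLM ℝ X ℝ volume 2 A).continuous.comp hg
  have h3 := (B.lpPairing (volume.restrict A) 2 2).continuous.comp h1
  exact h3.clm_apply h2

/-- Translation in time. -/
noncomputable def shift {Y : Type*} [NormedAddCommGroup Y] (s : ℝ)
    (F : Lp Y 2 (volume : Measure ℝ)) : Lp Y 2 (volume : Measure ℝ) :=
  DomAddAct.mk s +ᵥ F

theorem shift_ae_eq {Y : Type*} [NormedAddCommGroup Y] (s : ℝ) (F : Lp Y 2 (volume : Measure ℝ)) :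
    shift s F =ᵐ[volume] fun t => F (s + t) :=
  DomAddAct.vadd_Lp_ae_eq _ F

theorem shift_zero {Y : Type*} [NormedAddCommGroup Y] (F : Lp Y 2 (volume : Measure ℝ)) :
    shift 0 F = F := by
  simp [shift]

theorem continuous_shift {Y : Type*} [NormedAddCommGroup Y] (F : Lp Y 2 (volume : Measure ℝ)) :
    Continuous fun s => shift s F := by
  have : Fact ((2 : ENNReal) ≠ ⊤) := ⟨by simp⟩
  exact (DomAddAct.continuous_mk).vadd continuous_const

/-- Translation is strongly continuous on `L²` and the pairing is continuous. Continuity is joint in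
the two shifts because they tend to zero together in the limit of difference quotients. -/
theorem continuous_pairing_shift (A : Set ℝ) (F : Lp Z 2 (volume : Measure ℝ))
    (w : Lp X 2 (volume : Measure ℝ)) :
    Continuous fun z : ℝ × ℝ => pairing B A (shift z.1 F) (w + shift z.2 w) := by
  have c1 : Continuous fun z : ℝ × ℝ => shift z.1 F := (continuous_shift F).comp continuous_fst
  have c2 : Continuous fun z : ℝ × ℝ => shift z.2 w := (continuous_shift w).comp continuous_snd
  have c3 : Continuous fun z : ℝ × ℝ => w + shift z.2 w := (continuous_const_add w).comp c2
  exact continuous_pairing B A c1 c3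

/-- Fubini. The integrand is integrable because `(s, t) ↦ (s, s + t)` preserves the product measure,
so the shifted function is square integrable on the strip. -/
theorem integral_integral_shift (A : Set ℝ) (h : ℝ)
    (F : Lp Z 2 (volume : Measure ℝ)) (w : Lp X 2 (volume : Measure ℝ)) :
    ∫ t in A, (∫ s in Ioc 0 h, B (F (s + t)) (w t)) = ∫ s in Ioc 0 h, pairing B A (shift s F) w := by
  have hF : MemLp (fun z : ℝ × ℝ => F (z.1 + z.2)) 2
      ((volume.restrict (Ioc 0 h)).prod volume) :=
    ((Lp.memLp F).comp_snd (volume.restrict (Ioc 0 h))).comp_measurePreserving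
      (measurePreserving_prod_add _ _)
  have hw : MemLp (fun z : ℝ × ℝ => w z.2) 2 ((volume.restrict (Ioc 0 h)).prod volume) :=
    (Lp.memLp w).comp_snd (volume.restrict (Ioc 0 h))
  have hi : Integrable (fun z : ℝ × ℝ => B (F (z.1 + z.2)) (w z.2))
      ((volume.restrict (Ioc 0 h)).prod volume) :=
    memLp_one_iff_integrable.1
      (B.memLp_of_bilin 1 hF hw)
  have hi' : Integrable (Function.uncurry fun s t : ℝ => B (F (s + t)) (w t))
      ((volume.restrict (Ioc 0 h)).prod (volume.restrict A)) :=
    hi.mono_measure (Measure.prod_mono le_rfl Measure.restrict_le_self)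
  rw [← integral_integral_swap hi']
  congr 1
  ext s
  rw [pairing_eq_integral]
  apply integral_congr_ae
  filter_upwards [ae_restrict_of_ae (shift_ae_eq s F)] with t ht
  rw [ht]

end Pairing

/-! ### The energy identity by difference quotients. -/

section Energy

open Filter Topology

variable {X Y Z : Type*} [NormedAddCommGroup X] [NormedSpace ℝ X] [NormedAddCommGroup Y]
  [NormedSpace ℝ Y] [NormedAddCommGroup Z] [NormedSpace ℝ Z] (B : Z →L[ℝ] X →L[ℝ] ℝ)

/-- The increments of the energy over a time step `h`, averaged over `[0, β]`. -/
theorem integral_energy_increment {T β h : ℝ} (hh : 0 < h) (hβh : β + h ≤ T)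
    (b : Y →L[ℝ] Y →L[ℝ] ℝ) (hb : ∀ x y, b x y = b y x) (j : X →L[ℝ] Y)
    (w : Lp X 2 (volume : Measure ℝ)) (F : Lp Z 2 (volume : Measure ℝ))
    {rep : ℝ → Y} (hrep : ∀ᵐ t ∂volume.restrict (Icc 0 T), rep t = j (w t))
    (hd : ∀ v : X, ∀ s ∈ Icc 0 T, ∀ t ∈ Icc 0 T,
      b (rep t) (j v) - b (rep s) (j v) = ∫ x in s..t, B (F x) v) :
    ∫ t in Icc 0 β, (b (rep (h + t)) (rep (h + t)) - b (rep t) (rep t))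
      = ∫ s in Ioc 0 h, pairing B (Icc 0 β) (shift s F) (w + shift h w) := by
  rw [← integral_integral_shift]
  apply integral_congr_ae
  -- The representative must agree with `w` at `t` and at `h + t`; the second holds almost
  -- everywhere since translation preserves null sets.
  have hrep0 : ∀ᵐ t, t ∈ Icc 0 T → rep t = j (w t) := (ae_restrict_iff' measurableSet_Icc).1 hrep
  have hrep1 : ∀ᵐ t, h + t ∈ Icc 0 T → rep (h + t) = j (w (h + t)) :=
    (measurePreserving_add_left volume h).quasiMeasurePreserving.ae hrep0
  filter_upwards [ae_restrict_of_ae hrep0, ae_restrict_of_ae hrep1,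
    ae_restrict_of_ae (shift_ae_eq h w), ae_restrict_of_ae (Lp.coeFn_add w (shift h w)),
    ae_restrict_mem measurableSet_Icc] with t h1 h2 h3 h4 ht
  have m1 : t ∈ Icc 0 T := ⟨ht.1, by linarith [ht.2]⟩
  have m2 : h + t ∈ Icc 0 T := ⟨by linarith [ht.1], by linarith [ht.2]⟩
  -- By symmetry `b(y, y) - b(x, x) = b(y - x, x + y)`, so the increment law is tested, at each
  -- fixed `t`, with `w(t) + w(h + t)`.
  have hv : j ((w + shift h w : Lp X 2 volume) t) = rep t + rep (h + t) := by
    rw [h4, Pi.add_apply, h3, map_add, h1 m1, h2 m2]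
  have h5 := hd ((w + shift h w : Lp X 2 volume) t) t m1 (h + t) m2
  rw [hv] at h5
  have h6 := intervalIntegral.integral_comp_add_right (a := 0) (b := h)
    (fun x => B (F x) ((w + shift h w : Lp X 2 volume) t)) t
  rw [zero_add, ← h5, intervalIntegral.integral_of_le hh.le] at h6
  rw [h6]
  simp only [map_add]
  rw [hb (rep (h + t)) (rep t)]
  ring

/-- With `J h` the energy increment integrated over `[0, β]`, the limit of `J h / h` is computed
twice: as a derivative it is the energy at `β` minus that at `0`, while the averaged increments tend
to the pairing of `F` with `w + w`. The strict inequality `β < T` leaves room for the step `h`. -/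
theorem energy_sub_eq_pairing {T β : ℝ} (hβ : 0 ≤ β) (hβT : β < T)
    (b : Y →L[ℝ] Y →L[ℝ] ℝ) (hb : ∀ x y, b x y = b y x) (j : X →L[ℝ] Y)
    (w : Lp X 2 (volume : Measure ℝ)) (F : Lp Z 2 (volume : Measure ℝ))
    {rep : ℝ → Y} (hc : ContinuousOn rep (Icc 0 T))
    (hrep : ∀ᵐ t ∂volume.restrict (Icc 0 T), rep t = j (w t))
    (hd : ∀ v : X, ∀ s ∈ Icc 0 T, ∀ t ∈ Icc 0 T,
      b (rep t) (j v) - b (rep s) (j v) = ∫ x in s..t, B (F x) v) :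
    b (rep β) (rep β) - b (rep 0) (rep 0) = 2 * pairing B (Icc 0 β) F w := by
  have hT : 0 ≤ T := hβ.trans hβT.le
  -- Extending the energy continuously to all of `ℝ` makes `J` defined for every `h` and
  -- differentiable at `0`.
  set E : ℝ → ℝ := IccExtend hT fun t => b (rep t) (rep t) with hE
  have hEc : Continuous E := by
    have h1 : ContinuousOn (fun t => b (rep t) (rep t)) (Icc 0 T) :=
      (b.continuous.comp_continuousOn hc).clm_apply hc
    exact (continuousOn_iff_continuous_domRestrict.1 h1).Icc_extend'
  have hEe : ∀ t ∈ Icc 0 T, E t = b (rep t) (rep t) := fun t ht =>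
    IccExtend_of_mem hT (fun t : Icc 0 T => b (rep t) (rep t)) ht
  set K : ℝ → ℝ → ℝ := fun s h => pairing B (Icc 0 β) (shift s F) (w + shift h w) with hK
  have hKc : Continuous fun z : ℝ × ℝ => K z.1 z.2 :=
    continuous_pairing_shift B (Icc 0 β) F w
  have hK0 : K 0 0 = 2 * pairing B (Icc 0 β) F w := by
    simp only [hK, shift_zero, pairing_eq_integral]
    rw [← integral_const_mul]
    apply integral_congr_ae
    filter_upwards [ae_restrict_of_ae (Lp.coeFn_add w w)] with t ht
    rw [ht, Pi.add_apply, map_add]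
    ring
  set J : ℝ → ℝ := fun h => ∫ t in (0 : ℝ)..β, (E (h + t) - E t) with hJ
  have hJK : ∀ h, 0 < h → h ≤ T - β → J h = ∫ s in (0 : ℝ)..h, K s h := by
    intro h hh hle
    rw [intervalIntegral.integral_of_le hh.le]
    rw [← integral_energy_increment B hh (by linarith) b hb j w F hrep hd, hJ]
    simp only
    rw [intervalIntegral.integral_of_le hβ, ← integral_Icc_eq_integral_Ioc]
    apply setIntegral_congr_fun measurableSet_Icc
    intro t ht
    simp only
    rw [hEe t ⟨ht.1, by linarith [ht.2]⟩, hEe (h + t) ⟨by linarith [ht.1], by linarith [ht.2]⟩]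
  have hJd : HasDerivAt J (E β - E 0) 0 := by
    -- After translating the integral, `h` occurs only in limits of integration, and the fundamental
    -- theorem of calculus applies.
    have e : J = fun h => (∫ t in (0 : ℝ)..(h + β), E t) - (∫ t in (0 : ℝ)..h, E t)
        - ∫ t in (0 : ℝ)..β, E t := by
      ext h
      have ii : ∀ a b, IntervalIntegrable E volume a b := fun a b => hEc.intervalIntegrable a b
      simp only [hJ]
      have hs : Continuous fun t => E (h + t) := hEc.comp (continuous_const_add h)
      rw [intervalIntegral.integral_sub (hs.intervalIntegrable _ _) (ii _ _),
        intervalIntegral.integral_comp_add_left E h, add_zero,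
        intervalIntegral.integral_interval_sub_left (ii _ _) (ii _ _)]
    have p : ∀ x, HasDerivAt (fun x => ∫ t in (0 : ℝ)..x, E t) (E x) x := fun x =>
      intervalIntegral.integral_hasDerivAt_right (hEc.intervalIntegrable _ _)
        (hEc.stronglyMeasurableAtFilter _ _) hEc.continuousAt
    rw [e]
    have p1 : HasDerivAt (fun h => ∫ t in (0 : ℝ)..(h + β), E t) (E β) 0 := by
      have := (p (0 + β)).comp_add_const 0 β
      rwa [zero_add] at this
    exact (p1.sub (p 0)).sub_const _
  -- Only right limits are available, since `hJK` needs `0 < h`.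
  have l1 : Tendsto (fun h => h⁻¹ * J h) (𝓝[>] 0) (𝓝 (E β - E 0)) := by
    have h0 : J 0 = 0 := by simp [hJ]
    have := hJd.hasDerivWithinAt (s := Ioi 0)
    rw [hasDerivWithinAt_iff_tendsto_slope' (by simp)] at this
    refine this.congr fun h => ?_
    rw [slope_def_field, h0, sub_zero, sub_zero, div_eq_inv_mul]
  have l2 : Tendsto (fun h => h⁻¹ * J h) (𝓝[>] 0) (𝓝 (K 0 0)) := by
    rw [Metric.tendsto_nhds]
    intro ε hε
    -- In the average of `K s h` over `0 < s ≤ h`, both arguments lie within `δ` of `0` once `h <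
    -- δ`.
    obtain ⟨δ, hδ, hδK⟩ := Metric.continuousAt_iff.1 (hKc.continuousAt (x := ((0 : ℝ), (0 : ℝ))))
      (ε / 2) (by positivity)
    have hpos : 0 < min δ (T - β) := lt_min hδ (by linarith)
    filter_upwards [Ioo_mem_nhdsGT hpos] with h hh
    have hh0 : 0 < h := hh.1
    rw [hJK h hh0 (hh.2.le.trans (min_le_right _ _))]
    have hKi : IntervalIntegrable (fun s => K s h) volume 0 h :=
      (hKc.comp (continuous_id.prodMk continuous_const)).intervalIntegrable _ _
    have hb : ‖∫ s in (0 : ℝ)..h, (K s h - K 0 0)‖ ≤ ε / 2 * |h - 0| := by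
      apply intervalIntegral.norm_integral_le_of_norm_le_const
      intro s hs
      rw [uIoc_of_le hh0.le] at hs
      have hδ' : h < δ := hh.2.trans_le (min_le_left _ _)
      have := hδK (x := (s, h)) (by
        rw [Prod.dist_eq, max_lt_iff]
        simp only [Real.dist_eq, sub_zero]
        rw [abs_of_pos hs.1, abs_of_pos hh0]
        exact ⟨hs.2.trans_lt hδ', hδ'⟩)
      exact this.le
    rw [intervalIntegral.integral_sub hKi (by simp), intervalIntegral.integral_const, sub_zero,
      smul_eq_mul, abs_of_pos hh0] at hb
    rw [Real.dist_eq]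
    have e : h⁻¹ * (∫ s in (0 : ℝ)..h, K s h) - K 0 0
        = h⁻¹ * ((∫ s in (0 : ℝ)..h, K s h) - h * K 0 0) := by
      field_simp
    rw [e, abs_mul, abs_of_pos (inv_pos.2 hh0)]
    calc h⁻¹ * |(∫ s in (0 : ℝ)..h, K s h) - h * K 0 0| ≤ h⁻¹ * (ε / 2 * h) :=
          mul_le_mul_of_nonneg_left hb (inv_pos.2 hh0).le
      _ = ε / 2 := by field_simp
      _ < ε := by linarith
  have := tendsto_nhds_unique l1 l2
  rw [hK0, hEe β ⟨hβ, hβT.le⟩, hEe 0 ⟨le_rfl, hT⟩] at this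
  exact this

/-- **Energy identity**: if `d/dt b(u(t), j v) = B(F(t), v)` weakly for all `v`, with
`u ∈ L²(0, T; X) ∩ C([0, T]; Y)` and `F ∈ L²(0, T; Z)`, then
`b(u(T), u(T)) - b(u(0), u(0)) = 2 ∫ B(F, u)`. -/
theorem energy_identity {T : ℝ} (hT : 0 < T)
    (b : Y →L[ℝ] Y →L[ℝ] ℝ) (hb : ∀ x y, b x y = b y x) (j : X →L[ℝ] Y)
    {w : ℝ → X} (hw : MemLp w 2 (volume.restrict (Icc 0 T)))
    {F : ℝ → Z} (hF : MemLp F 2 (volume.restrict (Icc 0 T)))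
    {rep : ℝ → Y} (hc : ContinuousOn rep (Icc 0 T))
    (hrep : ∀ᵐ t ∂volume.restrict (Icc 0 T), rep t = j (w t))
    (hd : ∀ v : X, ∀ s ∈ Icc 0 T, ∀ t ∈ Icc 0 T,
      b (rep t) (j v) - b (rep s) (j v) = ∫ x in s..t, B (F x) v) :
    b (rep T) (rep T) - b (rep 0) (rep 0) = 2 * ∫ t in Icc 0 T, B (F t) (w t) := by
  -- Extension by zero to `ℝ`, where translations act.
  have hw' := (memLp_indicator_iff_restrict measurableSet_Icc).2 hw
  have hF' := (memLp_indicator_iff_restrict measurableSet_Icc).2 hF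
  have ew : ∀ᵐ t ∂volume.restrict (Icc 0 T), hw'.toLp _ t = w t := by
    filter_upwards [ae_restrict_of_ae hw'.coeFn_toLp, ae_restrict_mem measurableSet_Icc]
      with t h1 h2
    rw [h1, indicator_of_mem h2]
  have eF : ∀ᵐ t ∂volume.restrict (Icc 0 T), hF'.toLp _ t = F t := by
    filter_upwards [ae_restrict_of_ae hF'.coeFn_toLp, ae_restrict_mem measurableSet_Icc]
      with t h1 h2
    rw [h1, indicator_of_mem h2]
  have hint : IntegrableOn (fun t => B (F t) (w t)) (Icc 0 T) :=
    memLp_one_iff_integrable.1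
      (B.memLp_of_bilin 1 hF hw)
  have key : ∀ β ∈ Ico 0 T,
      b (rep β) (rep β) = b (rep 0) (rep 0) + 2 * ∫ t in (0 : ℝ)..β, B (F t) (w t) := by
    intro β hβ
    have := energy_sub_eq_pairing B hβ.1 hβ.2 b hb j (hw'.toLp _) (hF'.toLp _) hc
      (by filter_upwards [hrep, ew] with t h1 h2; rw [h1, h2]) (fun v s hs t ht => by
        rw [hd v s hs t ht]
        apply intervalIntegral.integral_congr_ae_restrict
        have hsub : uIoc s t ⊆ Icc 0 T := uIoc_subset_uIcc.trans (uIcc_subset_Icc hs ht)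
        filter_upwards [ae_restrict_of_ae_restrict_of_subset hsub eF] with x hx
        rw [hx])
    rw [pairing_eq_integral] at this
    rw [intervalIntegral.integral_of_le hβ.1, ← integral_Icc_eq_integral_Ioc]
    have e : ∫ t in Icc 0 β, B (F t) (w t) = ∫ t in Icc 0 β, B ((hF'.toLp _) t) ((hw'.toLp _) t) := by
      apply integral_congr_ae
      have hsub : Icc 0 β ⊆ Icc 0 T := Icc_subset_Icc_right hβ.2.le
      filter_upwards [ae_restrict_of_ae_restrict_of_subset hsub eF,
        ae_restrict_of_ae_restrict_of_subset hsub ew] with x h1 h2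
      rw [h1, h2]
    rw [e]
    linarith
  have c1 : ContinuousOn (fun t => b (rep t) (rep t)) (Icc 0 T) :=
    (b.continuous.comp_continuousOn hc).clm_apply hc
  have c2 : ContinuousOn (fun β => b (rep 0) (rep 0) + 2 * ∫ t in (0 : ℝ)..β, B (F t) (w t))
      (Icc 0 T) := by
    have := intervalIntegral.continuousOn_primitive_interval (a := 0) (b := T) (μ := volume)
      (f := fun t => B (F t) (w t)) (by rwa [uIcc_of_le hT.le])
    rw [uIcc_of_le hT.le] at this
    exact (this.const_mul 2).const_add _
  -- Both sides are continuous in `β` up to `T`, which recovers the endpoint.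
  have := EqOn.of_subset_closure (s := Ico 0 T) (t := Icc 0 T) key c1 c2 Ico_subset_Icc_self
    (by rw [closure_Ico hT.ne]) (right_mem_Icc.2 hT.le)
  simp only at this
  rw [this, intervalIntegral.integral_of_le hT.le, ← integral_Icc_eq_integral_Ioc]
  ring

end Energy

/-! ### Weighted quadratic forms and the algebra of mismatches. -/

section WeightedForm

open ENNReal

variable {α : Type*} {m : MeasurableSpace α} {μ : Measure α} {G : Type*} [NormedAddCommGroup G]
  [InnerProductSpace ℝ G]

/-- The bilinear form `∫ w ⟪A, B⟫` on `L²`, for a bounded weight `w`. -/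
noncomputable def weightedForm (w : Lp ℝ ∞ μ) : Lp G 2 μ →L[ℝ] Lp G 2 μ →L[ℝ] ℝ :=
  ((innerSL ℝ : G →L[ℝ] G →L[ℝ] ℝ).lpPairing μ 2 2) ∘L
    ((ContinuousLinearMap.lsmul ℝ ℝ : ℝ →L[ℝ] G →L[ℝ] G).holderL μ ∞ 2 2 w)

theorem weightedForm_toLp {w : α → ℝ} (hw : MemLp w ∞ μ) (A B : Lp G 2 μ) :
    weightedForm (hw.toLp w) A B = ∫ x, w x * ⟪A x, B x⟫ ∂μ := by
  rw [weightedForm, ContinuousLinearMap.comp_apply, ContinuousLinearMap.lpPairing_eq_integral]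
  apply integral_congr_ae
  filter_upwards [(ContinuousLinearMap.lsmul ℝ ℝ : ℝ →L[ℝ] G →L[ℝ] G).coeFn_holder (r := 2)
    (hw.toLp w) A, hw.coeFn_toLp] with x h1 h2
  simp only [ContinuousLinearMap.holderL_apply_apply]
  rw [h1, h2]
  exact real_inner_smul_left _ _ _

theorem weightedForm_comm (w : Lp ℝ ∞ μ) (A B : Lp G 2 μ) :
    weightedForm w A B = weightedForm w B A := by
  rw [← Lp.toLp_coeFn w (Lp.memLp w), weightedForm_toLp, weightedForm_toLp]
  simp_rw [real_inner_comm]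

theorem integrable_weight_mul_inner {w : α → ℝ} (hw : MemLp w ∞ μ) {A B : α → G}
    (hA : MemLp A 2 μ) (hB : MemLp B 2 μ) :
    Integrable (fun x => w x * ⟪A x, B x⟫) μ := by
  have h1 : MemLp (fun x => w x • A x) 2 μ := hA.smul hw
  have h2 := memLp_one_iff_integrable.1
    ((innerSL ℝ : G →L[ℝ] G →L[ℝ] ℝ).memLp_of_bilin 1 h1 hB)
  refine h2.congr (Filter.Eventually.of_forall fun x => ?_)
  exact real_inner_smul_left _ _ _

/-- The quadratic form `∫ w⁻¹ ‖w A - B‖²`, in expanded form; `w'` stands for `w⁻¹`. -/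
noncomputable def mismatchForm (w w' : Lp ℝ ∞ μ) (A B : Lp G 2 μ) : ℝ :=
  weightedForm w A A - 2 * ⟪A, B⟫ + weightedForm w' B B

/-- The expansion turns each mismatch into continuous bilinear forms on `L²`. Integrability in time
then follows from square integrability of `L²(Ω)`-valued maps, without joint measurability in `(t,
x)`. -/
theorem inv_mul_norm_smul_sub_sq {a : ℝ} (ha : 0 < a) (x y : G) :
    (1 / a) * ‖a • x - y‖ ^ 2 = a * ⟪x, x⟫ - 2 * ⟪x, y⟫ + (1 / a) * ⟪y, y⟫ := by
  rw [norm_sub_sq_real, real_inner_smul_left, norm_smul, Real.norm_of_nonneg ha.le,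
    real_inner_self_eq_norm_sq, real_inner_self_eq_norm_sq]
  field_simp

theorem ae_inv_mul_norm_sq_eq {w : α → ℝ} (hpos : ∀ᵐ x ∂μ, 0 < w x) (A B : Lp G 2 μ) :
    (fun x => (1 / w x) * ‖w x • A x - B x‖ ^ 2) =ᵐ[μ]
      fun x => w x * ⟪A x, A x⟫ - 2 * ⟪A x, B x⟫ + (1 / w x) * ⟪B x, B x⟫ := by
  filter_upwards [hpos] with x hx
  exact inv_mul_norm_smul_sub_sq hx _ _

theorem integrable_inv_mul_norm_sq {w : α → ℝ} (hpos : ∀ᵐ x ∂μ, 0 < w x) (hw : MemLp w ∞ μ)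
    (hw' : MemLp (fun x => 1 / w x) ∞ μ) (A B : Lp G 2 μ) :
    Integrable (fun x => (1 / w x) * ‖w x • A x - B x‖ ^ 2) μ :=
  (((integrable_weight_mul_inner hw (Lp.memLp A) (Lp.memLp A)).sub
    ((L2.integrable_inner (𝕜 := ℝ) A B).const_mul 2)).add
    (integrable_weight_mul_inner hw' (Lp.memLp B) (Lp.memLp B))).congr
    (ae_inv_mul_norm_sq_eq hpos A B).symm

theorem integral_inv_mul_norm_sq {w : α → ℝ} (hpos : ∀ᵐ x ∂μ, 0 < w x) (hw : MemLp w ∞ μ)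
    (hw' : MemLp (fun x => 1 / w x) ∞ μ) (A B : Lp G 2 μ) :
    ∫ x, (1 / w x) * ‖w x • A x - B x‖ ^ 2 ∂μ
      = mismatchForm (hw.toLp w) (hw'.toLp _) A B := by
  have i1 := integrable_weight_mul_inner hw (Lp.memLp A) (Lp.memLp A)
  have i2 := (L2.integrable_inner (𝕜 := ℝ) A B).const_mul 2
  have i3 := integrable_weight_mul_inner hw' (Lp.memLp B) (Lp.memLp B)
  have i12 : Integrable (fun x => w x * ⟪A x, A x⟫ - 2 * ⟪A x, B x⟫) μ := i1.sub i2
  rw [integral_congr_ae (ae_inv_mul_norm_sq_eq hpos A B), integral_add i12 i3,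
    integral_sub i1 i2, integral_const_mul, mismatchForm, weightedForm_toLp, weightedForm_toLp,
    L2.inner_def]

/-- Since `w A - (B + w A') / 2 = w (A - A' / 2) - B / 2`, the averaged error is again a mismatch.
-/
theorem integral_inv_mul_norm_sub_average_sq {w : α → ℝ} (hpos : ∀ᵐ x ∂μ, 0 < w x)
    (hw : MemLp w ∞ μ) (hw' : MemLp (fun x => 1 / w x) ∞ μ) (A A' B : Lp G 2 μ) :
    ∫ x, (1 / w x) * ‖w x • A x - (1 / 2 : ℝ) • (B x + w x • A' x)‖ ^ 2 ∂μ
      = mismatchForm (hw.toLp w) (hw'.toLp _) (A - (1 / 2 : ℝ) • A') ((1 / 2 : ℝ) • B) := by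
  rw [← integral_inv_mul_norm_sq hpos]
  apply integral_congr_ae
  filter_upwards [Lp.coeFn_sub A ((1 / 2 : ℝ) • A'), Lp.coeFn_smul (1 / 2 : ℝ) A',
    Lp.coeFn_smul (1 / 2 : ℝ) B] with x h1 h2 h3
  rw [h1, Pi.sub_apply, h2, h3, Pi.smul_apply, Pi.smul_apply]
  congr 3
  rw [smul_add, smul_sub, smul_comm (w x)]
  abel

section Time

variable {β : Type*} {m' : MeasurableSpace β} {ν : Measure β}

theorem integrable_bilin {X Y : Type*} [NormedAddCommGroup X] [NormedSpace ℝ X]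
    [NormedAddCommGroup Y] [NormedSpace ℝ Y] (b : X →L[ℝ] Y →L[ℝ] ℝ) {A : β → X} {B : β → Y}
    (hA : MemLp A 2 ν) (hB : MemLp B 2 ν) : Integrable (fun t => b (A t) (B t)) ν :=
  memLp_one_iff_integrable.1 (b.memLp_of_bilin 1 hA hB)

theorem integrable_weightedForm (w : Lp ℝ ∞ μ) {A B : β → Lp G 2 μ} (hA : MemLp A 2 ν)
    (hB : MemLp B 2 ν) : Integrable (fun t => weightedForm w (A t) (B t)) ν := by
  have h := integrable_bilin (weightedForm w) hA hB
  exact h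

theorem integrable_inner_of_memLp {A B : β → G} (hA : MemLp A 2 ν) (hB : MemLp B 2 ν) :
    Integrable (fun t => ⟪A t, B t⟫) ν := by
  have h := integrable_bilin (innerSL ℝ : G →L[ℝ] G →L[ℝ] ℝ) hA hB
  exact h

theorem integrable_mismatchForm (w w' : Lp ℝ ∞ μ) {A B : β → Lp G 2 μ} (hA : MemLp A 2 ν)
    (hB : MemLp B 2 ν) : Integrable (fun t => mismatchForm w w' (A t) (B t)) ν :=
  ((integrable_weightedForm w hA hA).sub ((integrable_inner_of_memLp hA hB).const_mul 2)).add
    (integrable_weightedForm w' hB hB)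

/-- The work `∫ ⟪w U - Q, U - H⟫` of the flux error `w U - Q` on the gradient error `U - H`. -/
noncomputable def crossForm (w : Lp ℝ ∞ μ) (U H Q : Lp G 2 μ) : ℝ :=
  weightedForm w U (U - H) - ⟪Q, U - H⟫

theorem integrable_crossForm (w : Lp ℝ ∞ μ) {U H Q : β → Lp G 2 μ} (hU : MemLp U 2 ν)
    (hH : MemLp H 2 ν) (hQ : MemLp Q 2 ν) :
    Integrable (fun t => crossForm w (U t) (H t) (Q t)) ν :=
  (integrable_weightedForm w hU (hU.sub hH)).sub (integrable_inner_of_memLp hQ (hU.sub hH))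

/-- The square of `w H - Q = (w U - Q) - w (U - H)`. The weight `w'` multiplies only the `Q`-term,
common to both sides, so no relation between `w` and `w'` is needed. -/
theorem mismatchForm_eq_add_sub (w w' : Lp ℝ ∞ μ) (U H Q : Lp G 2 μ) :
    mismatchForm w w' H Q
      = mismatchForm w w' U Q + weightedForm w (U - H) (U - H) - 2 * crossForm w U H Q := by
  simp only [mismatchForm, crossForm, map_sub, sub_apply, inner_sub_right]
  rw [weightedForm_comm w H U, real_inner_comm Q U, real_inner_comm Q H]
  ring

/-- Here `w U - (Q + w H) / 2` is half the sum of `w U - Q` and `w (U - H)`, whereas `w H - Q` is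
their difference; the two squares differ by the cross term. -/
theorem two_mul_mismatchForm_average (w w' : Lp ℝ ∞ μ) (U H Q : Lp G 2 μ) :
    2 * mismatchForm w w' (U - (1 / 2 : ℝ) • H) ((1 / 2 : ℝ) • Q)
      = (1 / 2) * mismatchForm w w' H Q + 2 * crossForm w U H Q := by
  simp only [mismatchForm, crossForm, map_sub, map_smul, sub_apply,
    smul_apply, inner_sub_right, inner_sub_left, real_inner_smul_left,
    real_inner_smul_right, smul_eq_mul]
  rw [weightedForm_comm w H U, real_inner_comm Q U, real_inner_comm Q H]
  ring

theorem integral_mismatchForm_eq (w w' : Lp ℝ ∞ μ) {U H Q : β → Lp G 2 μ} (hU : MemLp U 2 ν)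
    (hH : MemLp H 2 ν) (hQ : MemLp Q 2 ν) :
    ∫ t, mismatchForm w w' (H t) (Q t) ∂ν
      = ∫ t, mismatchForm w w' (U t) (Q t) ∂ν
        + ∫ t, weightedForm w (U t - H t) (U t - H t) ∂ν
        - 2 * ∫ t, crossForm w (U t) (H t) (Q t) ∂ν := by
  have i1 := integrable_mismatchForm w w' hU hQ
  have i2 : Integrable (fun t => weightedForm w (U t - H t) (U t - H t)) ν :=
    integrable_weightedForm w (hU.sub hH) (hU.sub hH)
  have i3 := (integrable_crossForm w hU hH hQ).const_mul 2
  have i12 : Integrable (fun t => mismatchForm w w' (U t) (Q t)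
    + weightedForm w (U t - H t) (U t - H t)) ν := i1.add i2
  rw [integral_congr_ae (Filter.Eventually.of_forall fun t =>
    mismatchForm_eq_add_sub w w' (U t) (H t) (Q t)), integral_sub i12 i3, integral_add i1 i2, integral_const_mul]

theorem two_mul_integral_mismatchForm_average (w w' : Lp ℝ ∞ μ) {U H Q : β → Lp G 2 μ}
    (hU : MemLp U 2 ν) (hH : MemLp H 2 ν) (hQ : MemLp Q 2 ν) :
    2 * ∫ t, mismatchForm w w' (U t - (1 / 2 : ℝ) • H t) ((1 / 2 : ℝ) • Q t) ∂ν
      = (1 / 2) * ∫ t, mismatchForm w w' (H t) (Q t) ∂ν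
        + 2 * ∫ t, crossForm w (U t) (H t) (Q t) ∂ν := by
  have i1 := (integrable_mismatchForm w w' hH hQ).const_mul (1 / 2)
  have i2 := (integrable_crossForm w hU hH hQ).const_mul 2
  rw [← integral_const_mul]
  rw [integral_congr_ae (Filter.Eventually.of_forall fun t =>
    two_mul_mismatchForm_average w w' (U t) (H t) (Q t)), integral_add i1 i2, integral_const_mul, integral_const_mul]

end Time

end WeightedForm

/-! ### Weighted forms attached to positive coefficients. -/

section Coefficients

open ENNReal

variable {d : ℕ} {Ω : Set (Space d)} {w : Space d → ℝ}

theorem IsPositiveCoefficient.ae_pos (hw : IsPositiveCoefficient Ω w) :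
    ∀ᵐ x ∂volume.restrict Ω, 0 < w x := by
  obtain ⟨-, a, b, ha, h⟩ := hw
  filter_upwards [h] with x hx
  exact ha.trans_le hx.1

theorem IsPositiveCoefficient.memLp_top (hw : IsPositiveCoefficient Ω w) :
    MemLp w ∞ (volume.restrict Ω) := by
  obtain ⟨hm, a, b, ha, h⟩ := hw
  refine memLp_top_of_bound hm.aestronglyMeasurable b ?_
  filter_upwards [h] with x hx
  rw [Real.norm_of_nonneg (ha.le.trans hx.1)]
  exact hx.2

theorem IsPositiveCoefficient.memLp_top_inv (hw : IsPositiveCoefficient Ω w) :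
    MemLp (fun x => 1 / w x) ∞ (volume.restrict Ω) := by
  obtain ⟨hm, a, b, ha, h⟩ := hw
  refine memLp_top_of_bound (aemeasurable_const.div hm).aestronglyMeasurable (1 / a) ?_
  filter_upwards [h] with x hx
  rw [Real.norm_of_nonneg (one_div_nonneg.2 (ha.le.trans hx.1))]
  exact one_div_le_one_div_of_le ha hx.1

/-- The form `∫_Ω w ⟪A, B⟫` of a coefficient. -/
noncomputable def IsPositiveCoefficient.form {G : Type*} [NormedAddCommGroup G]
    [InnerProductSpace ℝ G] (hw : IsPositiveCoefficient Ω w) :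
    Lp G 2 (volume.restrict Ω) →L[ℝ] Lp G 2 (volume.restrict Ω) →L[ℝ] ℝ :=
  weightedForm (hw.memLp_top.toLp w)

variable {G : Type*} [NormedAddCommGroup G] [InnerProductSpace ℝ G]

theorem IsPositiveCoefficient.form_apply (hw : IsPositiveCoefficient Ω w)
    (A B : Lp G 2 (volume.restrict Ω)) : hw.form A B = ∫ x in Ω, w x * ⟪A x, B x⟫ :=
  weightedForm_toLp _ _ _

theorem IsPositiveCoefficient.form_comm (hw : IsPositiveCoefficient Ω w)
    (A B : Lp G 2 (volume.restrict Ω)) : hw.form A B = hw.form B A :=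
  weightedForm_comm _ _ _

theorem IsPositiveCoefficient.normSq_eq (hw : IsPositiveCoefficient Ω w)
    (A : Lp G 2 (volume.restrict Ω)) : normSq Ω w A = hw.form A A := by
  simp_rw [hw.form_apply, normSq, real_inner_self_eq_norm_sq]

/-- The form `∫_Ω w⁻¹ ‖w A - B‖²` of a coefficient. -/
noncomputable def IsPositiveCoefficient.mismatch (hw : IsPositiveCoefficient Ω w)
    (A B : Lp G 2 (volume.restrict Ω)) : ℝ :=
  mismatchForm (hw.memLp_top.toLp w) (hw.memLp_top_inv.toLp _) A B

theorem IsPositiveCoefficient.integrable_mismatch_density (hw : IsPositiveCoefficient Ω w)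
    (A B : Lp G 2 (volume.restrict Ω)) :
    Integrable (fun x => (1 / w x) * ‖B x - w x • A x‖ ^ 2) (volume.restrict Ω) := by
  simp_rw [norm_sub_rev (B _)]
  exact integrable_inv_mul_norm_sq hw.ae_pos hw.memLp_top hw.memLp_top_inv A B

theorem IsPositiveCoefficient.normSq_smul_sub (hw : IsPositiveCoefficient Ω w)
    (A B : Lp G 2 (volume.restrict Ω)) :
    normSq Ω (fun x => 1 / w x) (fun x => w x • A x - B x) = hw.mismatch A B :=
  integral_inv_mul_norm_sq hw.ae_pos _ _ A B

theorem IsPositiveCoefficient.normSq_sub_smul (hw : IsPositiveCoefficient Ω w)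
    (A B : Lp G 2 (volume.restrict Ω)) :
    normSq Ω (fun x => 1 / w x) (fun x => B x - w x • A x) = hw.mismatch A B := by
  rw [← hw.normSq_smul_sub]
  simp_rw [normSq, norm_sub_rev (B _)]

theorem IsPositiveCoefficient.normSq_smul_sub_average (hw : IsPositiveCoefficient Ω w)
    (A A' B : Lp G 2 (volume.restrict Ω)) :
    normSq Ω (fun x => 1 / w x) (fun x => w x • A x - (1 / 2 : ℝ) • (B x + w x • A' x))
      = hw.mismatch (A - (1 / 2 : ℝ) • A') ((1 / 2 : ℝ) • B) :=
  integral_inv_mul_norm_sub_average_sq hw.ae_pos _ _ A A' B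

end Coefficients

/-! ### The energy identity in the parabolic space. -/

section Dual

variable {X Y : Type*} [NormedAddCommGroup X] [NormedSpace ℝ X] [NormedAddCommGroup Y]
  [NormedSpace ℝ Y]

theorem integrable_dual_apply {ν : Measure ℝ} {F : ℝ → StrongDual ℝ X} {w : ℝ → X}
    (hF : MemLp F 2 ν) (hw : MemLp w 2 ν) : Integrable (fun t => F t (w t)) ν := by
  have h := integrable_bilin (ContinuousLinearMap.id ℝ (StrongDual ℝ X)) hF hw
  exact h

theorem memLp_dual_sub {ν : Measure ℝ} {F F' : ℝ → StrongDual ℝ X}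
    (hF : MemLp F 2 ν) (hF' : MemLp F' 2 ν) : MemLp (fun t => F t - F' t) 2 ν := by
  have h := MemLp.sub hF hF'
  exact h

/-- The energy identity for the difference of two functions with zero initial values. -/
theorem energy_identity_dual_sub {T : ℝ} (hT : 0 < T)
    (b : Y →L[ℝ] Y →L[ℝ] ℝ) (hb : ∀ x y, b x y = b y x) (j : X →L[ℝ] Y)
    {w w' : ℝ → X} (hw : MemLp w 2 (volume.restrict (Icc 0 T)))
    (hw' : MemLp w' 2 (volume.restrict (Icc 0 T)))
    {F F' : ℝ → StrongDual ℝ X} (hF : MemLp F 2 (volume.restrict (Icc 0 T)))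
    (hF' : MemLp F' 2 (volume.restrict (Icc 0 T)))
    {y y' : ℝ → Y} (hc : ContinuousOn y (Icc 0 T)) (hc' : ContinuousOn y' (Icc 0 T))
    (h0 : y 0 = 0) (h0' : y' 0 = 0)
    (hy : ∀ᵐ t ∂volume.restrict (Icc 0 T), y t = j (w t))
    (hy' : ∀ᵐ t ∂volume.restrict (Icc 0 T), y' t = j (w' t))
    (hd : ∀ v : X, ∀ s ∈ Icc 0 T, ∀ t ∈ Icc 0 T,
      b (y t) (j v) - b (y s) (j v) = ∫ x in s..t, F x v)
    (hd' : ∀ v : X, ∀ s ∈ Icc 0 T, ∀ t ∈ Icc 0 T,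
      b (y' t) (j v) - b (y' s) (j v) = ∫ x in s..t, F' x v) :
    b (y T - y' T) (y T - y' T) = 2 * ∫ t in Icc 0 T, (F t - F' t) (w t - w' t) := by
  have hint : ∀ G : ℝ → StrongDual ℝ X, MemLp G 2 (volume.restrict (Icc 0 T)) → ∀ v : X,
      ∀ s ∈ Icc 0 T, ∀ t ∈ Icc 0 T, IntervalIntegrable (fun x => G x v) volume s t := by
    intro G hG v s hs t ht
    have h2 : IntegrableOn (fun x => G x v) (Icc 0 T) := integrable_dual_apply hG (memLp_const v)
    rw [intervalIntegrable_iff]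
    exact h2.mono_set (uIoc_subset_uIcc.trans (uIcc_subset_Icc hs ht))
  have h := energy_identity (ContinuousLinearMap.id ℝ (StrongDual ℝ X)) hT b hb j (hw.sub hw')
    (memLp_dual_sub hF hF') (hc.sub hc')
    (by
      filter_upwards [hy, hy'] with t h1 h2
      rw [Pi.sub_apply, Pi.sub_apply, h1, h2, map_sub])
    (fun v s hs t ht => by
      have e : ∀ x, (ContinuousLinearMap.id ℝ (StrongDual ℝ X) (F x - F' x)) v
        = F x v - F' x v := fun x => rfl
      simp_rw [e]
      rw [intervalIntegral.integral_sub (hint F hF v s hs t ht) (hint F' hF' v s hs t ht),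
        ← hd v s hs t ht, ← hd' v s hs t ht]
      simp only [Pi.sub_apply, map_sub, sub_apply]
      ring)
  simp only [Pi.sub_apply, h0, h0', sub_self, map_zero, sub_zero] at h
  exact h

end Dual

instance isFiniteMeasure_timeMeasure (T : ℝ) : IsFiniteMeasure (timeMeasure T) := by
  unfold timeMeasure
  infer_instance

section Fields

variable {d : ℕ} {Ω Γu : Set (Space d)}

/-- `fn` as a continuous linear map. -/
noncomputable def fnL (Ω Γu : Set (Space d)) : V Ω Γu →L[ℝ] ScalarL2 Ω :=
  (WithLp.fstL 2 ℝ (ScalarL2 Ω) (VectorL2 Ω)) ∘L (V Ω Γu).subtypeL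

/-- `grad` as a continuous linear map. -/
noncomputable def gradL (Ω Γu : Set (Space d)) : V Ω Γu →L[ℝ] VectorL2 Ω :=
  (WithLp.sndL 2 ℝ (ScalarL2 Ω) (VectorL2 Ω)) ∘L (V Ω Γu).subtypeL

theorem fnL_apply (v : V Ω Γu) : fnL Ω Γu v = fn v := rfl

theorem fn_sub (v w : V Ω Γu) : fn (v - w) = fn v - fn w := rfl

theorem grad_sub (v w : V Ω Γu) : grad (v - w) = grad v - grad w := rfl

theorem memLp_fn {ν : Measure ℝ} {v : ℝ → V Ω Γu} (hv : MemLp v 2 ν) :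
    MemLp (fun t => fn (v t)) 2 ν := by
  have h := (fnL Ω Γu).comp_memLp' hv
  exact h

theorem memLp_grad {ν : Measure ℝ} {v : ℝ → V Ω Γu} (hv : MemLp v 2 ν) :
    MemLp (fun t => grad (v t)) 2 ν := by
  have h := (gradL Ω Γu).comp_memLp' hv
  exact h

variable {w : Space d → ℝ}

theorem IsPositiveCoefficient.integrable_mul_mul (hw : IsPositiveCoefficient Ω w)
    (A B : ScalarL2 Ω) : Integrable (fun x => w x * A x * B x) (volume.restrict Ω) := by
  refine (integrable_weight_mul_inner hw.memLp_top (Lp.memLp A) (Lp.memLp B)).congr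
    (Filter.Eventually.of_forall fun x => ?_)
  simp only [RCLike.inner_apply, conj_trivial]
  ring

theorem IsPositiveCoefficient.form_real (hw : IsPositiveCoefficient Ω w) (A B : ScalarL2 Ω) :
    hw.form A B = ∫ x in Ω, w x * A x * B x := by
  rw [hw.form_apply]
  congr 1
  ext x
  simp only [RCLike.inner_apply, conj_trivial]
  ring

theorem inner_real_eq (A B : ScalarL2 Ω) : ⟪A, B⟫ = ∫ x in Ω, A x * B x := by
  rw [L2.inner_def]
  congr 1
  ext x
  simp only [RCLike.inner_apply, conj_trivial]
  ring

end Fields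

section Parabolic

variable {d : ℕ} {Ω Γu : Set (Space d)} {T : ℝ} {c : Space d → ℝ}

/-- For fixed `v` the scalar function `t ↦ ∫ c u(t) v` is continuous through `rep` and has the
integrable weak derivative `t ↦ u.cdt t v`. -/
theorem ParabolicSpace.form_sub_eq_integral (hT : 0 < T) (hc : IsPositiveCoefficient Ω c)
    (u : ParabolicSpace Ω Γu T c) (v : V Ω Γu) {s t : ℝ} (hs : s ∈ Icc 0 T) (ht : t ∈ Icc 0 T) :
    hc.form (u.rep t) (fn v) - hc.form (u.rep s) (fn v) = ∫ x in s..t, u.cdt x v := by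
  have hF : IntegrableOn (fun x => u.cdt x v) (Icc 0 T) := by
    have h1 := integrable_dual_apply u.memLp_cdt (memLp_const v)
    exact h1
  refine sub_eq_integral_of_weak_derivative hT (h := fun t => hc.form (u.rep t) (fn v)) ?_ hF ?_
    hs ht
  · exact (hc.form.continuous.comp_continuousOn u.continuousOn_rep).clm_apply continuousOn_const
  · intro φ h1 h2 h3
    refine Eq.trans ?_ (u.weak_derivative φ h1 h2 h3 v)
    apply integral_congr_ae
    filter_upwards [u.rep_ae_eq] with t ht
    rw [ht, hc.form_real]

theorem ParabolicSpace.energy_identity_sub (hT : 0 < T) (hc : IsPositiveCoefficient Ω c)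
    (u u' : ParabolicSpace Ω Γu T c) (h0 : u.rep 0 = 0) (h0' : u'.rep 0 = 0) :
    hc.form (u.rep T - u'.rep T) (u.rep T - u'.rep T)
      = 2 * ∫ t, (u.cdt t - u'.cdt t) (u.toFun t - u'.toFun t) ∂timeMeasure T := by
  have e1 : ∀ᵐ t ∂volume.restrict (Icc 0 T), u.rep t = fnL Ω Γu (u.toFun t) := u.rep_ae_eq
  have e2 : ∀ᵐ t ∂volume.restrict (Icc 0 T), u'.rep t = fnL Ω Γu (u'.toFun t) := u'.rep_ae_eq
  have d1 : ∀ v : V Ω Γu, ∀ s ∈ Icc 0 T, ∀ t ∈ Icc 0 T, hc.form (u.rep t) (fnL Ω Γu v)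
      - hc.form (u.rep s) (fnL Ω Γu v) = ∫ x in s..t, u.cdt x v :=
    fun v s hs t ht => u.form_sub_eq_integral hT hc v hs ht
  have d2 : ∀ v : V Ω Γu, ∀ s ∈ Icc 0 T, ∀ t ∈ Icc 0 T, hc.form (u'.rep t) (fnL Ω Γu v)
      - hc.form (u'.rep s) (fnL Ω Γu v) = ∫ x in s..t, u'.cdt x v :=
    fun v s hs t ht => u'.form_sub_eq_integral hT hc v hs ht
  have h := energy_identity_dual_sub (X := V Ω Γu) (Y := ScalarL2 Ω) hT hc.form hc.form_comm
    (fnL Ω Γu) u.memLp_toFun u'.memLp_toFun u.memLp_cdt u'.memLp_cdt u.continuousOn_rep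
    u'.continuousOn_rep h0 h0' e1 e2 d1 d2
  exact h

end Parabolic

theorem integral_sub_add_integral_sub {β : Type*} {m : MeasurableSpace β} {ν : Measure β}
    {a₁ a₂ a₃ b₁ b₂ b₃ : β → ℝ} (ha₁ : Integrable a₁ ν) (ha₂ : Integrable a₂ ν)
    (ha₃ : Integrable a₃ ν) (hb₁ : Integrable b₁ ν) (hb₂ : Integrable b₂ ν)
    (hb₃ : Integrable b₃ ν)
    (h : ∫ t, (a₁ t + (a₂ t + a₃ t)) ∂ν = ∫ t, (b₁ t + (b₂ t + b₃ t)) ∂ν) :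
    (∫ t, (a₂ t - b₂ t) ∂ν) + ∫ t, (a₃ t - b₃ t) ∂ν = - ∫ t, (a₁ t - b₁ t) ∂ν := by
  have ha : Integrable (fun t => a₂ t + a₃ t) ν := ha₂.add ha₃
  have hb : Integrable (fun t => b₂ t + b₃ t) ν := hb₂.add hb₃
  rw [integral_add ha₁ ha, integral_add ha₂ ha₃, integral_add hb₁ hb, integral_add hb₂ hb₃] at h
  rw [integral_sub ha₁ hb₁, integral_sub ha₂ hb₂, integral_sub ha₃ hb₃]
  linarith

/-! ### Orthogonality and the extended Prager-Synge identities. -/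

section PragerSynge

variable {d : ℕ} {Ω Γu Γq : Set (Space d)} {T : ℝ} {c k r : Space d → ℝ}

/-- The form `∫ ⟪w U - Q, U - H⟫` of a coefficient. -/
noncomputable def IsPositiveCoefficient.cross {G : Type*} [NormedAddCommGroup G]
    [InnerProductSpace ℝ G] {w : Space d → ℝ} (hw : IsPositiveCoefficient Ω w)
    (U H Q : Lp G 2 (volume.restrict Ω)) : ℝ :=
  crossForm (hw.memLp_top.toLp w) U H Q

theorem integral_coefficients_eq_form (hk : IsPositiveCoefficient Ω k)
    (hr : IsPositiveCoefficient Ω r) (a b : V Ω Γu) :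
    ∫ x in Ω, (k x * ⟪grad a x, grad b x⟫ + r x * fn a x * fn b x)
      = hk.form (grad a) (grad b) + hr.form (fn a) (fn b) := by
  rw [integral_add (integrable_weight_mul_inner hk.memLp_top (Lp.memLp _) (Lp.memLp _))
    (hr.integrable_mul_mul _ _), hk.form_apply, hr.form_real]

theorem integrable_mul_scalarL2 (A B : ScalarL2 Ω) :
    Integrable (fun x => A x * B x) (volume.restrict Ω) :=
  MemLp.integrable_mul (p := 2) (q := 2) (Lp.memLp A) (Lp.memLp B)

theorem integral_flux_eq_inner (q : VectorL2 Ω) (z : ScalarL2 Ω) (v : V Ω Γu) :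
    ∫ x in Ω, (⟪q x, grad v x⟫ + z x * fn v x) = ⟪q, grad v⟫ + ⟪z, fn v⟫ := by
  rw [integral_add (L2.integrable_inner (𝕜 := ℝ) q (grad v)) (integrable_mul_scalarL2 z (fn v)),
    L2.inner_def, inner_real_eq]

/-- Orthogonality: the work of the flux errors balances the final energy. -/
theorem integral_cross_add_integral_cross (hT : 0 < T) (hc : IsPositiveCoefficient Ω c)
    (hk : IsPositiveCoefficient Ω k) (hr : IsPositiveCoefficient Ω r) {f : ℝ → ScalarL2 Ω}
    {g : ℝ → Lp ℝ 2 ((surfaceMeasure Ω).restrict Γq)} {u û : ParabolicSpace Ω Γu T c}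
    (hu : IsWeakSolution k r f g u) {q : ℝ → VectorL2 Ω} {z : ℝ → ScalarL2 Ω}
    (hadm : IsAdmissible f g û q z) :
    2 * ((∫ t, hk.cross (grad (u.toFun t)) (grad (û.toFun t)) (q t) ∂timeMeasure T)
      + ∫ t, hr.cross (fn (u.toFun t)) (fn (û.toFun t)) (z t) ∂timeMeasure T)
      = - hc.form (u.rep T - û.rep T) (u.rep T - û.rep T) := by
  have he : MemLp (fun t => u.toFun t - û.toFun t) 2 (timeMeasure T) := by
    have h := u.memLp_toFun.sub û.memLp_toFun
    exact h
  have hue := memLp_grad u.memLp_toFun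
  have hûe := memLp_grad û.memLp_toFun
  have hun := memLp_fn u.memLp_toFun
  have hûn := memLp_fn û.memLp_toFun
  have hgrade := memLp_grad he
  have hfne := memLp_fn he
  have i1 := integrable_dual_apply u.memLp_cdt he
  have i2 := integrable_weightedForm (hk.memLp_top.toLp k) hue hgrade
  have i3 := integrable_weightedForm (hr.memLp_top.toLp r) hun hfne
  have i1' := integrable_dual_apply û.memLp_cdt he
  have i2' := integrable_inner_of_memLp hadm.memLp_q hgrade
  have i3' := integrable_inner_of_memLp hadm.memLp_z hfne
  -- The error is a legitimate test function: it lies in `L²(I; 𝒱)`.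
  have hweak := hu.2 _ he
  -- Equilibrium holds for all `v` at almost every `t`, so `v` may be the error at that time; this
  -- eliminates the load.
  have hload : ∫ t, load Γq (f t) (g t) (u.toFun t - û.toFun t) ∂timeMeasure T
      = ∫ t, (û.cdt t (u.toFun t - û.toFun t) + (⟪q t, grad (u.toFun t - û.toFun t)⟫
        + ⟪z t, fn (u.toFun t - û.toFun t)⟫)) ∂timeMeasure T := by
    apply integral_congr_ae
    filter_upwards [hadm.equilibrium] with t ht
    rw [← ht, integral_flux_eq_inner]
  simp_rw [integral_coefficients_eq_form hk hr] at hweak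
  rw [hload] at hweak
  have h := integral_sub_add_integral_sub i1 i2 i3 i1' i2' i3' hweak
  rw [u.energy_identity_sub hT hc û hu.1 hadm.initial]
  have h1 : ∀ t, hk.cross (grad (u.toFun t)) (grad (û.toFun t)) (q t)
      = weightedForm (hk.memLp_top.toLp k) (grad (u.toFun t)) (grad (u.toFun t - û.toFun t))
        - ⟪q t, grad (u.toFun t - û.toFun t)⟫ := fun t => by rw [grad_sub]; rfl
  have h2 : ∀ t, hr.cross (fn (u.toFun t)) (fn (û.toFun t)) (z t)
      = weightedForm (hr.memLp_top.toLp r) (fn (u.toFun t)) (fn (u.toFun t - û.toFun t))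
        - ⟪z t, fn (u.toFun t - û.toFun t)⟫ := fun t => by rw [fn_sub]; rfl
  simp_rw [h1, h2]
  rw [h]
  simp_rw [sub_apply]
  ring

section Time

variable {G : Type*} [NormedAddCommGroup G] [InnerProductSpace ℝ G] {w : Space d → ℝ}
  {U H Q : ℝ → Lp G 2 (volume.restrict Ω)} {ν : Measure ℝ}

theorem IsPositiveCoefficient.integrable_mismatch (hw : IsPositiveCoefficient Ω w)
    (hH : MemLp H 2 ν) (hQ : MemLp Q 2 ν) :
    Integrable (fun t => hw.mismatch (H t) (Q t)) ν := by
  have h := integrable_mismatchForm (hw.memLp_top.toLp w) (hw.memLp_top_inv.toLp _) hH hQ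
  exact h

theorem IsPositiveCoefficient.integral_mismatch_eq (hw : IsPositiveCoefficient Ω w)
    (hU : MemLp U 2 ν) (hH : MemLp H 2 ν) (hQ : MemLp Q 2 ν) :
    ∫ t, hw.mismatch (H t) (Q t) ∂ν
      = ∫ t, hw.mismatch (U t) (Q t) ∂ν + ∫ t, hw.form (U t - H t) (U t - H t) ∂ν
        - 2 * ∫ t, hw.cross (U t) (H t) (Q t) ∂ν := by
  have h := integral_mismatchForm_eq (hw.memLp_top.toLp w) (hw.memLp_top_inv.toLp _) hU hH hQ
  exact h

theorem IsPositiveCoefficient.two_mul_integral_mismatch_average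
    (hw : IsPositiveCoefficient Ω w) (hU : MemLp U 2 ν) (hH : MemLp H 2 ν) (hQ : MemLp Q 2 ν) :
    2 * ∫ t, hw.mismatch (U t - (1 / 2 : ℝ) • H t) ((1 / 2 : ℝ) • Q t) ∂ν
      = (1 / 2) * ∫ t, hw.mismatch (H t) (Q t) ∂ν
        + 2 * ∫ t, hw.cross (U t) (H t) (Q t) ∂ν := by
  have h := two_mul_integral_mismatchForm_average (hw.memLp_top.toLp w)
    (hw.memLp_top_inv.toLp _) hU hH hQ
  exact h

theorem IsPositiveCoefficient.mismatch_nonneg (hw : IsPositiveCoefficient Ω w)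
    (A B : Lp G 2 (volume.restrict Ω)) : 0 ≤ hw.mismatch A B := by
  rw [← hw.normSq_smul_sub]
  apply integral_nonneg_of_ae
  filter_upwards [hw.ae_pos] with x hx
  exact mul_nonneg (one_div_nonneg.2 hx.le) (sq_nonneg _)

end Time

theorem creSq_eq (hk : IsPositiveCoefficient Ω k) (hr : IsPositiveCoefficient Ω r)
    {û : ℝ → V Ω Γu} (hû : MemLp û 2 (timeMeasure T)) {q : ℝ → VectorL2 Ω} {z : ℝ → ScalarL2 Ω}
    (hq : MemLp q 2 (timeMeasure T)) (hz : MemLp z 2 (timeMeasure T)) :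
    creSq T k r û (fun t => q t) (fun t => z t)
      = ∫ t, hk.mismatch (grad (û t)) (q t) ∂timeMeasure T
        + ∫ t, hr.mismatch (fn (û t)) (z t) ∂timeMeasure T := by
  rw [← integral_add (hk.integrable_mismatch (memLp_grad hû) hq)
    (hr.integrable_mismatch (memLp_fn hû) hz), creSq]
  congr 1
  ext t
  have h1 := hk.integrable_mismatch_density (grad (û t)) (q t)
  have h2 := hr.integrable_mismatch_density (fn (û t)) (z t)
  rw [← hk.normSq_sub_smul, ← hr.normSq_sub_smul, normSq, normSq, ← integral_add h1 h2]
  simp only [Real.norm_eq_abs, sq_abs, smul_eq_mul]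

/-- The extended Prager-Synge identities. -/
theorem prager_synge (hT : 0 < T) (hc : IsPositiveCoefficient Ω c)
    (hk : IsPositiveCoefficient Ω k) (hr : IsPositiveCoefficient Ω r) {f : ℝ → ScalarL2 Ω}
    {g : ℝ → Lp ℝ 2 ((surfaceMeasure Ω).restrict Γq)} {u û : ParabolicSpace Ω Γu T c}
    (hu : IsWeakSolution k r f g u) {q : ℝ → VectorL2 Ω} {z : ℝ → ScalarL2 Ω}
    (hadm : IsAdmissible f g û q z) :
    creSq T k r û.toFun (fun t => q t) (fun t => z t)
      = triNormSq Ω T (fun x => 1 / k x) (fun t x => k x • grad (u.toFun t) x - q t x)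
        + triNormSq Ω T (fun x => 1 / r x) (fun t x => r x * fn (u.toFun t) x - z t x)
        + triNormSq Ω T k (fun t => grad (u.toFun t - û.toFun t))
        + triNormSq Ω T r (fun t => fn (u.toFun t - û.toFun t))
        + normSq Ω c (u.rep T - û.rep T)
    ∧ creSq T k r û.toFun (fun t => q t) (fun t => z t)
      ≥ energyNormSq T c k r (fun t => u.toFun t - û.toFun t) (u.rep T - û.rep T)
    ∧ (1 / 2 : ℝ) * creSq T k r û.toFun (fun t => q t) (fun t => z t)
      = 2 * triNormSq Ω T (fun x => 1 / k x)
          (fun t x => k x • grad (u.toFun t) x - (1 / 2 : ℝ) • (q t x + k x • grad (û.toFun t) x))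
        + 2 * triNormSq Ω T (fun x => 1 / r x)
          (fun t x => r x * fn (u.toFun t) x - (1 / 2 : ℝ) * (z t x + r x * fn (û.toFun t) x))
        + normSq Ω c (u.rep T - û.rep T) := by
  have hcross := integral_cross_add_integral_cross hT hc hk hr hu hadm
  have hgu := memLp_grad u.memLp_toFun
  have hgû := memLp_grad û.memLp_toFun
  have hfu := memLp_fn u.memLp_toFun
  have hfû := memLp_fn û.memLp_toFun
  have k1 := hk.integral_mismatch_eq hgu hgû hadm.memLp_q
  have r1 := hr.integral_mismatch_eq hfu hfû hadm.memLp_z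
  have k2 := hk.two_mul_integral_mismatch_average hgu hgû hadm.memLp_q
  have r2 := hr.two_mul_integral_mismatch_average hfu hfû hadm.memLp_z
  have t1 : triNormSq Ω T (fun x => 1 / k x) (fun t x => k x • grad (u.toFun t) x - q t x)
      = ∫ t, hk.mismatch (grad (u.toFun t)) (q t) ∂timeMeasure T := by
    simp_rw [← hk.normSq_smul_sub]
    rfl
  have t2 : triNormSq Ω T (fun x => 1 / r x) (fun t x => r x * fn (u.toFun t) x - z t x)
      = ∫ t, hr.mismatch (fn (u.toFun t)) (z t) ∂timeMeasure T := by
    simp_rw [← hr.normSq_smul_sub]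
    rfl
  have t3 : triNormSq Ω T k (fun t => grad (u.toFun t - û.toFun t))
      = ∫ t, hk.form (grad (u.toFun t) - grad (û.toFun t)) (grad (u.toFun t) - grad (û.toFun t))
        ∂timeMeasure T := by
    simp_rw [triNormSq, hk.normSq_eq, grad_sub]
  have t4 : triNormSq Ω T r (fun t => fn (u.toFun t - û.toFun t))
      = ∫ t, hr.form (fn (u.toFun t) - fn (û.toFun t)) (fn (u.toFun t) - fn (û.toFun t))
        ∂timeMeasure T := by
    simp_rw [triNormSq, hr.normSq_eq, fn_sub]
  have t5 : triNormSq Ω T (fun x => 1 / k x)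
      (fun t x => k x • grad (u.toFun t) x - (1 / 2 : ℝ) • (q t x + k x • grad (û.toFun t) x))
      = ∫ t, hk.mismatch (grad (u.toFun t) - (1 / 2 : ℝ) • grad (û.toFun t)) ((1 / 2 : ℝ) • q t)
        ∂timeMeasure T := by
    simp_rw [← hk.normSq_smul_sub_average]
    rfl
  have t6 : triNormSq Ω T (fun x => 1 / r x)
      (fun t x => r x * fn (u.toFun t) x - (1 / 2 : ℝ) * (z t x + r x * fn (û.toFun t) x))
      = ∫ t, hr.mismatch (fn (u.toFun t) - (1 / 2 : ℝ) • fn (û.toFun t)) ((1 / 2 : ℝ) • z t)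
        ∂timeMeasure T := by
    simp_rw [← hr.normSq_smul_sub_average]
    rfl
  -- Dropping the two flux errors, which are nonnegative, yields the inequality.
  have n1 : 0 ≤ ∫ t, hk.mismatch (grad (u.toFun t)) (q t) ∂timeMeasure T :=
    integral_nonneg fun t => hk.mismatch_nonneg _ _
  have n2 : 0 ≤ ∫ t, hr.mismatch (fn (u.toFun t)) (z t) ∂timeMeasure T :=
    integral_nonneg fun t => hr.mismatch_nonneg _ _
  rw [energyNormSq, creSq_eq hk hr û.memLp_toFun hadm.memLp_q hadm.memLp_z, t1, t2, t3, t4, t5, t6,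
    hc.normSq_eq]
  refine ⟨?_, ?_, ?_⟩ <;> linarith

end PragerSynge

/-! ### Separated approximations as admissible functions. -/

section Modes

variable {X : Type*} [NormedAddCommGroup X] [NormedSpace ℝ X] {m : ℕ} {ν : Measure ℝ}

theorem memLp_sum_smul {s : Fin m → ℝ → ℝ} (hs : ∀ i, MemLp (s i) 2 ν) (v : Fin m → X) :
    MemLp (fun t => ∑ i, s i t • v i) 2 ν :=
  memLp_finsetSum _ fun i _ => (ContinuousLinearMap.toSpanSingleton ℝ (v i)).comp_memLp' (hs i)

theorem memLp_sum_smul_dual {s : Fin m → ℝ → ℝ} (hs : ∀ i, MemLp (s i) 2 ν)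
    (F : Fin m → StrongDual ℝ X) : MemLp (fun t => ∑ i, s i t • F i) 2 ν := by
  have h := memLp_sum_smul hs F
  exact h

end Modes

section PGD

open ENNReal

variable {d np m : ℕ} {Ω Γu Γq : Set (Space d)} {T : ℝ} {P : Fin np → Set ℝ} {c k r : Space d → ℝ}

/-- Multiplication by a coefficient. -/
noncomputable def IsPositiveCoefficient.mulL {w : Space d → ℝ} (hw : IsPositiveCoefficient Ω w) :
    ScalarL2 Ω →L[ℝ] ScalarL2 Ω :=
  (ContinuousLinearMap.lsmul ℝ ℝ : ℝ →L[ℝ] ℝ →L[ℝ] ℝ).holderL (volume.restrict Ω) ∞ 2 2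
    (hw.memLp_top.toLp w)

theorem IsPositiveCoefficient.coeFn_mulL {w : Space d → ℝ} (hw : IsPositiveCoefficient Ω w)
    (A : ScalarL2 Ω) : hw.mulL A =ᵐ[volume.restrict Ω] fun x => w x * A x := by
  filter_upwards [(ContinuousLinearMap.lsmul ℝ ℝ : ℝ →L[ℝ] ℝ →L[ℝ] ℝ).coeFn_holder (r := 2)
    (hw.memLp_top.toLp w) A, hw.memLp_top.coeFn_toLp] with x h1 h2
  rw [IsPositiveCoefficient.mulL, ContinuousLinearMap.holderL_apply_apply, h1, h2]
  rfl

theorem memLp_of_absolutelyContinuous (hT : 0 < T) {l : ℝ → ℝ}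
    (hl : AbsolutelyContinuousOnInterval l 0 T) : MemLp l 2 (timeMeasure T) := by
  have hc : ContinuousOn l (Icc 0 T) := by
    have h := hl.continuousOn
    rwa [uIcc_of_le hT.le] at h
  obtain ⟨C, hC⟩ := isCompact_Icc.exists_bound_of_continuousOn hc
  refine MemLp.of_bound (hc.aestronglyMeasurable measurableSet_Icc) C ?_
  filter_upwards [ae_restrict_mem measurableSet_Icc] with t ht
  exact hC t ht

/-- The functional `v ↦ ∫_Ω c A v`. -/
noncomputable def IsPositiveCoefficient.dual (hc : IsPositiveCoefficient Ω c) (Γu : Set (Space d))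
    (A : ScalarL2 Ω) : StrongDual ℝ (V Ω Γu) :=
  (hc.form A) ∘L (fnL Ω Γu)

theorem IsPositiveCoefficient.dual_apply (hc : IsPositiveCoefficient Ω c) (A : ScalarL2 Ω)
    (v : V Ω Γu) : hc.dual Γu A v = hc.form A (fn v) := rfl

theorem form_fn_sum (hc : IsPositiveCoefficient Ω c) (s : Fin m → ℝ) (v : Fin m → V Ω Γu)
    (w : V Ω Γu) : hc.form (fn (∑ i, s i • v i)) (fn w)
      = ∑ i, s i * hc.form (fn (v i)) (fn w) := by
  have h : fn (∑ i, s i • v i) = ∑ i, s i • fn (v i) := by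
    rw [← fnL_apply, map_sum]
    rfl
  rw [h, map_sum, sum_apply]
  refine Finset.sum_congr rfl fun i _ => ?_
  rw [map_smul, smul_apply, smul_eq_mul]

/-- A separated approximation as a function in the parabolic space. -/
noncomputable def PGDApproximation.toParabolicSpace (U : PGDApproximation Ω Γu T P m) (hT : 0 < T)
    (hc : IsPositiveCoefficient Ω c) (p : Fin np → ℝ) : ParabolicSpace Ω Γu T c where
  toFun := U.eval p
  cdt t := ∑ i, (deriv (U.time i) t * ∏ j, U.param i j (p j)) • hc.dual Γu (fn (U.space i))
  rep t := fn (U.eval p t)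
  memLp_toFun := by
    have h := memLp_sum_smul (fun i => (memLp_of_absolutelyContinuous hT (U.time_ac i)).mul_const
      (∏ j, U.param i j (p j))) U.space
    exact h
  memLp_cdt := by
    have h := memLp_sum_smul_dual (fun i => (U.time_deriv i).mul_const (∏ j, U.param i j (p j)))
      (fun i => hc.dual Γu (fn (U.space i)))
    exact h
  continuousOn_rep := by
    have h : ContinuousOn (U.eval p) (Icc 0 T) := by
      refine continuousOn_finsetSum _ fun i _ => ?_
      have h1 := (U.time_ac i).continuousOn
      rw [uIcc_of_le hT.le] at h1
      exact (h1.mul continuousOn_const).smul continuousOn_const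
    exact (fnL Ω Γu).continuous.comp_continuousOn h
  rep_ae_eq := Filter.Eventually.of_forall fun _ => rfl
  weak_derivative φ h1 h2 h3 v := by
    -- Space and parameter factors are constant in time, so the weak derivative reduces to one
    -- integration by parts per time mode.
    set a : Fin m → ℝ := fun i => (∏ j, U.param i j (p j)) * hc.form (fn (U.space i)) (fn v)
      with ha
    have e1 : ∀ t, deriv φ t * (∫ x in Ω, c x * fn (U.eval p t) x * fn v x)
        = ∑ i, (deriv φ t * U.time i t) * a i := by
      intro t
      rw [← hc.form_real, PGDApproximation.eval, form_fn_sum, Finset.mul_sum]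
      refine Finset.sum_congr rfl fun i _ => ?_
      rw [ha]
      ring
    have e2 : ∀ t, φ t * (∑ i, (deriv (U.time i) t * ∏ j, U.param i j (p j)) •
        hc.dual Γu (fn (U.space i))) v = ∑ i, (φ t * deriv (U.time i) t) * a i := by
      intro t
      rw [sum_apply, Finset.mul_sum]
      refine Finset.sum_congr rfl fun i _ => ?_
      rw [smul_apply, hc.dual_apply, smul_eq_mul, ha]
      ring
    simp_rw [e1, e2]
    have i1 : ∀ i, Integrable (fun t => deriv φ t * U.time i t) (timeMeasure T) := by
      intro i
      have h := (U.time_ac i).continuousOn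
      rw [uIcc_of_le hT.le] at h
      exact ((h1.continuous_deriv (by simp)).continuousOn.mul h).integrableOn_Icc
    have i2 : ∀ i, Integrable (fun t => φ t * deriv (U.time i) t) (timeMeasure T) := by
      intro i
      have h : IntegrableOn (deriv (U.time i)) (Icc 0 T) := (U.time_deriv i).integrable (by simp)
      exact h.continuousOn_mul h1.continuous.continuousOn isCompact_Icc
    rw [integral_finsetSum _ fun i _ => (i1 i).mul_const (a i),
      integral_finsetSum _ fun i _ => (i2 i).mul_const (a i), ← Finset.sum_neg_distrib]
    refine Finset.sum_congr rfl fun i _ => ?_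
    rw [integral_mul_const, integral_mul_const, ← neg_mul]
    congr 1
    exact integral_deriv_test_mul hT (U.time_ac i) h1 h3

theorem PGDApproximation.toParabolicSpace_cdt (U : PGDApproximation Ω Γu T P m) (hT : 0 < T)
    (hc : IsPositiveCoefficient Ω c) (p : Fin np → ℝ) (t : ℝ) (v : V Ω Γu) :
    (U.toParabolicSpace hT hc p).cdt t v = ∫ x in Ω, c x * fn (U.evalDeriv p t) x * fn v x := by
  rw [← hc.form_real, PGDApproximation.evalDeriv, form_fn_sum]
  simp only [PGDApproximation.toParabolicSpace]
  rw [sum_apply]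
  rfl

/-- An admissible `ẑ` takes values in `L²(Ω)`, so the pointwise product `r u_m` enters through
`mulL`; the equilibrium of `u_m` is then that of the triplet. -/
theorem IsEquilibratedFlux.isAdmissible {f : ℝ → ScalarL2 Ω}
    {g : ℝ → Lp ℝ 2 ((surfaceMeasure Ω).restrict Γq)} {U : PGDApproximation Ω Γu T P m}
    {p : Fin np → ℝ} {q : ℝ → VectorL2 Ω} (hq : IsEquilibratedFlux c r f g U p q) (hT : 0 < T)
    (hp : p ∈ Set.univ.pi P) (hc : IsPositiveCoefficient Ω c) (hr : IsPositiveCoefficient Ω r) :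
    IsAdmissible f g (U.toParabolicSpace hT hc p) q (fun t => hr.mulL (fn (U.eval p t))) where
  initial := by
    have h : U.eval p 0 = 0 := U.initial p hp
    change fn (U.eval p 0) = 0
    rw [h]
    rfl
  memLp_q := hq.memLp_q
  memLp_z := by
    have h := hr.mulL.comp_memLp' (memLp_fn (U.toParabolicSpace hT hc p).memLp_toFun)
    exact h
  equilibrium := by
    filter_upwards [hq.equilibrium] with t ht v
    have i1 : Integrable (fun x => ⟪q t x, grad v x⟫ + hr.mulL (fn (U.eval p t)) x * fn v x)
        (volume.restrict Ω) :=
      (L2.integrable_inner (𝕜 := ℝ) (q t) (grad v)).add (integrable_mul_scalarL2 _ (fn v))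
    rw [← ht v, U.toParabolicSpace_cdt hT hc, ← integral_add (hc.integrable_mul_mul _ _) i1]
    apply integral_congr_ae
    filter_upwards [hr.coeFn_mulL (fn (U.eval p t))] with x hx
    rw [hx, add_assoc]

theorem creSq_mulL (hr : IsPositiveCoefficient Ω r) (û : ℝ → V Ω Γu) (q : ℝ → VectorL2 Ω) :
    creSq T k r û (fun t => q t) (fun t => hr.mulL (fn (û t)))
      = creSq T k r û (fun t => q t) (fun t x => r x * fn (û t) x) := by
  unfold creSq
  congr 1
  ext t
  apply integral_congr_ae
  filter_upwards [hr.coeFn_mulL (fn (û t))] with x hx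
  rw [hx]

theorem creSq_constitutive (û : ℝ → V Ω Γu) (q : ℝ → VectorL2 Ω) :
    creSq T k r û (fun t => q t) (fun t x => r x * fn (û t) x)
      = triNormSq Ω T (fun x => 1 / k x) (fun t x => q t x - k x • grad (û t) x) := by
  simp [creSq, triNormSq, normSq]

end PGD

end CRE

theorem mainTheorem1 {d np : ℕ} (Ω Γu Γq : Set (Space d)) (hΩ : IsLipschitzDomain Ω)
    (hΓu : Γu ⊆ frontier Ω) (hΓq : Γq ⊆ frontier Ω) (hΓu_ne : Γu.Nonempty)
    (hΓ_disj : Disjoint Γu Γq) (hΓ_cover : closure (Γu ∪ Γq) = frontier Ω)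
    (hΓu_meas : MeasurableSet Γu) (hΓq_meas : MeasurableSet Γq)
    (T : ℝ) (hT : 0 < T)
    (P : Fin np → Set ℝ) (hP : ∀ j, Bornology.IsBounded (P j))
    (c k r : Space d → (Fin np → ℝ) → ℝ)
    (hc : ∀ p ∈ Set.univ.pi P, IsPositiveCoefficient Ω (fun x => c x p))
    (hk : ∀ p ∈ Set.univ.pi P, IsPositiveCoefficient Ω (fun x => k x p))
    (hr : ∀ p ∈ Set.univ.pi P, IsPositiveCoefficient Ω (fun x => r x p))
    (f : ℝ → ScalarL2 Ω) (hf : MemLp f 2 (timeMeasure T))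
    (g : ℝ → Lp ℝ 2 ((surfaceMeasure Ω).restrict Γq)) (hg : MemLp g 2 (timeMeasure T))
    (u : ∀ p : Fin np → ℝ, ParabolicSpace Ω Γu T (fun x => c x p))
    (hu : ∀ p ∈ Set.univ.pi P, IsWeakSolution (fun x => k x p) (fun x => r x p) f g (u p)) :
    -- Extended Prager-Synge equality, inequality, and equality with averaged fluxes
    (∀ p ∈ Set.univ.pi P, ∀ (û : ParabolicSpace Ω Γu T (fun x => c x p))
      (qh : ℝ → VectorL2 Ω) (zh : ℝ → ScalarL2 Ω), IsAdmissible f g û qh zh →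
      creSq T (fun x => k x p) (fun x => r x p) û.toFun (fun t => qh t) (fun t => zh t)
        = triNormSq Ω T (fun x => 1 / k x p)
            (fun t x => k x p • grad ((u p).toFun t) x - qh t x)
          + triNormSq Ω T (fun x => 1 / r x p)
            (fun t x => r x p * fn ((u p).toFun t) x - zh t x)
          + triNormSq Ω T (fun x => k x p) (fun t => grad ((u p).toFun t - û.toFun t))
          + triNormSq Ω T (fun x => r x p) (fun t => fn ((u p).toFun t - û.toFun t))
          + normSq Ω (fun x => c x p) ((u p).rep T - û.rep T)
      ∧ creSq T (fun x => k x p) (fun x => r x p) û.toFun (fun t => qh t) (fun t => zh t)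
        ≥ energyNormSq T (fun x => c x p) (fun x => k x p) (fun x => r x p)
            (fun t => (u p).toFun t - û.toFun t) ((u p).rep T - û.rep T)
      ∧ (1 / 2 : ℝ) *
          creSq T (fun x => k x p) (fun x => r x p) û.toFun (fun t => qh t) (fun t => zh t)
        = 2 * triNormSq Ω T (fun x => 1 / k x p)
            (fun t x => k x p • grad ((u p).toFun t) x
              - (1 / 2 : ℝ) • (qh t x + k x p • grad (û.toFun t) x))
          + 2 * triNormSq Ω T (fun x => 1 / r x p)
            (fun t x => r x p * fn ((u p).toFun t) x
              - (1 / 2 : ℝ) * (zh t x + r x p * fn (û.toFun t) x))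
          + normSq Ω (fun x => c x p) ((u p).rep T - û.rep T))
    ∧
    -- Guaranteed error bound for the PGD approximation with an equilibrated flux
    (∀ (m : ℕ) (U : PGDApproximation Ω Γu T P m) (qm : (Fin np → ℝ) → ℝ → VectorL2 Ω),
      (∀ p ∈ Set.univ.pi P,
        IsEquilibratedFlux (fun x => c x p) (fun x => r x p) f g U p (qm p)) →
      ∀ p ∈ Set.univ.pi P,
        creSq T (fun x => k x p) (fun x => r x p) (U.eval p) (fun t => qm p t)
            (fun t x => r x p * fn (U.eval p t) x)
          = triNormSq Ω T (fun x => 1 / k x p)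
              (fun t x => qm p t x - k x p • grad (U.eval p t) x)
        ∧ creSq T (fun x => k x p) (fun x => r x p) (U.eval p) (fun t => qm p t)
            (fun t x => r x p * fn (U.eval p t) x)
          ≥ energyNormSq T (fun x => c x p) (fun x => k x p) (fun x => r x p)
              (fun t => (u p).toFun t - U.eval p t) ((u p).rep T - fn (U.eval p T))) := by
  refine ⟨fun p hp û qh zh hadm => prager_synge hT (hc p hp) (hk p hp) (hr p hp) (hu p hp) hadm,
    fun m U qm hqm p hp => ⟨creSq_constitutive _ _, ?_⟩⟩
  have h := (prager_synge hT (hc p hp) (hk p hp) (hr p hp) (hu p hp)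
    ((hqm p hp).isAdmissible hT hp (hc p hp) (hr p hp))).2.1
  -- The error bound concerns the class `mulL`, the claim the pointwise product; they agree almost
  -- everywhere in `Ω`.
  have e : creSq T (fun x => k x p) (fun x => r x p) (U.eval p) (fun t => qm p t)
      (fun t => (hr p hp).mulL (fn (U.eval p t))) = _ := creSq_mulL (hr p hp) (U.eval p) (qm p)
  rw [← e]
  exact h
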